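/- **Setting.** Let $L\ge 1$, let $p_0=d,p_1,\dots,p_L,p_{L+1}=1$ be layer widths, and let $\mathcal A$ be the set of all $\Theta=(W^L,\dots,W^0)$ with $W^l\in\mathbb R^{p_{l+1}\times p_l}$; let $P=\sum_{l=0}^L p_{l+1}p_l$. For activation functions $f^l:\mathbb R^{p_l}\to\mathbb R^{p_l}$ ($1\le l\le L$) that satisfy $f^l[0]=0$, are $a_{\rm Lip}$-Lipschitz for the Euclidean norms ($a_{\rm Lip}\in[0,\infty)$) and are nonnegative homogeneous of degree one, let $$g_\Theta[x]=W^Lf^L\big[W^{L-1}\cdots W^1f^1[W^0x]\big],\qquad x\in\mathbb R^d .$$ For matrices $G=(G^L,\dots,G^0)$, $G^l$ having $p_{l+1}$ columns, and $\nu>0$ let $$h_{G,\nu}[\Theta]=\sum_{l=0}^L\|G^lW^l\|_1+\nu\sum_{l=0}^L\|\Pi_{G^l}W^l\|_1,\qquad M_G=\max_{0\le l\le L}\big\|(\bar G^l)^{-1}\big\|_{1\to1},$$ where $\|\cdot\|_1$ is the entrywise $\ell_1$ norm, $\Pi_{G^l}$ is the orthogonal projection of the columns onto $\ker G^l$, $\bar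 G^l:(\ker G^l)^\perp\to\operatorname{Im}G^l$ is the bijection induced by $G^l$, and $\|\cdot\|_{1\to1}$ is the operator norm with respect to the $\ell_1$ norms. Let $y_i=g[x_i]+u_i$, $i=1,\dots,n$, where $g:\mathbb R^d\to\mathbb R$ is arbitrary, $x_1,\dots,x_n\in\mathbb R^d$ are fixed, and the real random variables $u_i$ are independent, centered and satisfy $\max_iK^2\big(\mathbb E e^{|u_i|^2/K^2}-1\big)\le\gamma^2$ with $K,\gamma\in(0,\infty)$. Put $\|x\|_n=\sqrt{\sum_{i=1}^n\|x_i\|_2^2/n}$. For a penalty $h$ let $\mathcal A_h=\{\Theta\in\mathcal A:h[\Theta]\le1\}$, let $\operatorname{err}^2(\kappa g_\Omega)=\frac1n\sum_{i=1}^n(g[x_i]-\kappa g_\Omega[x_i])^2$, and call $(\hat\kappa,\hat\Omega)$ an estimator with tuning parameter $\lambda$ if it minimizes $\frac1n\sum_{i=1}^n(y_i-\kappa g_\Omega[x_i])^2+\lambda\kappa$ over $\kappa\in[0,\infty)$, $\Omega\in\mathcal A_h$. **Corollary (standard $\ell_1$-sparsity).** Let $G=0$. 1. $M_0=0$; for $\nu=1$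 the regularizer is the $\ell_1$ penalty, $h_{0,1}[\Theta]=\sum_{l=0}^L\|W^l\|_1$; and the lower bound $C(M_G+1)(a_{\rm Lip})^{2L}\|x\|_n^2\big(\tfrac{\sqrt2}{L}\big)^{2L-1}\sqrt{\log(2P)}\,\tfrac{\log(2n)}{\sqrt n}$ on the tuning parameter becomes the right-hand side of $(*)$. 2. Let $h=h_{0,1}$. There is a constant $C\in(0,\infty)$ that depends only on $K$ and $\gamma$ such that, if $$\lambda\ \ge\ C\,(a_{\rm Lip})^{2L}\,\|x\|_n^2\Big(\frac{\sqrt2}{L}\Big)^{2L-1}\sqrt{\log(2P)}\;\frac{\log(2n)}{\sqrt n}\qquad(*)$$ and $n$ is large enough, then, with probability at least $1-1/n$, every estimator $(\hat\kappa,\hat\Omega)$ satisfies $$\operatorname{err}^2(\hat\kappa g_{\hat\Omega})\ \le\ \inf_{\kappa\in[0,\infty),\ \Omega\in\mathcal A_h}\big\{\operatorname{err}^2(\kappa g_\Omega)+2\lambda\kappa\big\}.$$ Here "$n$ large enough" means $n\ge N$, where $N$ depends only on $K$, $\gamma$, $L$ and $s=(a_{\rm Lip})^L\|x\|_n$, and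 is nonincreasing in $s\in(0,\infty)$; in particular $N$ does not depend on the widths, the number $P$ of parameters, the inputs other than through $s$, the activation functions, or $g$. -/

import Mathlib

open MeasureTheory ProbabilityTheory

noncomputable section

namespace SparseNet

/-- The parameter space: tuples of weight matrices `W l`, `l = 0, …, L`, where `W l` has size
`p (l + 1) × p l`. Only the widths `p 0, …, p (L + 1)` matter. -/
abbrev Params (L : ℕ) (p : ℕ → ℕ) : Type :=
  (l : Fin (L + 1)) → Matrix (Fin (p (l + 1))) (Fin (p l)) ℝ

/-- A family of matrices `G l`, `l = 0, …, L`, with `m l` rows, acting from the left on `W l`. -/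
abbrev RegMatrices (L : ℕ) (p m : ℕ → ℕ) : Type :=
  (l : Fin (L + 1)) → Matrix (Fin (m l)) (Fin (p (l + 1))) ℝ

/-- Activation functions: `f l` is applied to the output of `W l`, for `l = 0, …, L - 1`. -/
abbrev Activations (L : ℕ) (p : ℕ → ℕ) : Type :=
  (l : Fin L) → EuclideanSpace ℝ (Fin (p (l + 1))) → EuclideanSpace ℝ (Fin (p (l + 1)))

/-- The total number of parameters. -/
def numParams (L : ℕ) (p : ℕ → ℕ) : ℕ := ∑ l : Fin (L + 1), p (l + 1) * p l

/-- Each activation function fixes the origin, is `a`-Lipschitz for the Euclidean norms, and is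
nonnegative homogeneous of degree one. -/
structure Admissible {L : ℕ} {p : ℕ → ℕ} (a : ℝ) (f : Activations L p) : Prop where
  map_zero : ∀ l, f l 0 = 0
  lipschitz : ∀ l z z', ‖f l z - f l z'‖ ≤ a * ‖z - z'‖
  homogeneous : ∀ l (s : ℝ) z, 0 ≤ s → f l (s • z) = s • f l z

/-- The vector `W l (f (l-1) (W (l-1) (… f 0 (W 0 x))))`. -/
def preactivation {L : ℕ} {p : ℕ → ℕ} (f : Activations L p) (W : Params L p)
    (x : EuclideanSpace ℝ (Fin (p 0))) :
    (l : ℕ) → l < L + 1 → EuclideanSpace ℝ (Fin (p (l + 1)))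
  | 0, h => Matrix.toEuclideanLin (W ⟨0, h⟩) x
  | l + 1, h => Matrix.toEuclideanLin (W ⟨l + 1, h⟩)
      (f ⟨l, Nat.lt_of_succ_lt_succ h⟩ (preactivation f W x l (Nat.lt_of_succ_lt h)))

/-- The real-valued network with parameters `W` (the output layer has width one). -/
def network {L : ℕ} {p : ℕ → ℕ} (hp : p (L + 1) = 1) (f : Activations L p) (W : Params L p)
    (x : EuclideanSpace ℝ (Fin (p 0))) : ℝ :=
  preactivation f W x L (Nat.lt_succ_self L) (Fin.cast hp.symm 0)

/-- The entrywise `ℓ₁` norm of a matrix. -/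
def matrixL1 {r c : ℕ} (B : Matrix (Fin r) (Fin c) ℝ) : ℝ := ∑ k, ∑ j, |B k j|

/-- The `ℓ₁` norm of the parameters. -/
def l1Penalty {L : ℕ} {p : ℕ → ℕ} (W : Params L p) : ℝ := ∑ l, matrixL1 (W l)

/-- The `ℓ₁` norm of a vector. -/
def vecL1 {r : ℕ} (v : EuclideanSpace ℝ (Fin r)) : ℝ := ∑ i, |v i|

/-- The kernel of a matrix, acting on column vectors. -/
def kernel {r q : ℕ} (G : Matrix (Fin r) (Fin q) ℝ) : Submodule ℝ (EuclideanSpace ℝ (Fin q)) :=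
  LinearMap.ker (Matrix.toEuclideanLin G)

/-- The columnwise orthogonal projection of `W` onto the kernel of `G`. -/
def kernelProj {r q c : ℕ} (G : Matrix (Fin r) (Fin q) ℝ) (W : Matrix (Fin q) (Fin c) ℝ) :
    Matrix (Fin q) (Fin c) ℝ :=
  Matrix.of fun i j => (kernel G).starProjection (WithLp.toLp 2 fun i' => W i' j) i

/-- The regularizer `‖G Θ‖₁ + ν ‖Π_G Θ‖₁`. -/
def regularizer {L : ℕ} {p m : ℕ → ℕ} (G : RegMatrices L p m) (ν : ℝ) (W : Params L p) : ℝ :=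
  ∑ l, matrixL1 (G l * W l) + ν * ∑ l, matrixL1 (kernelProj (G l) (W l))

/-- The invertible map `(ker G)ᗮ → Im G` induced by `G`. -/
def inducedEquiv {r q : ℕ} (G : Matrix (Fin r) (Fin q) ℝ) :
    (kernel G)ᗮ ≃ₗ[ℝ] LinearMap.range (Matrix.toEuclideanLin G) :=
  LinearMap.kerComplementEquivRange (Matrix.toEuclideanLin G)
    (Submodule.isCompl_orthogonal (kernel G)).symm

/-- The operator norm, from `ℓ₁` to `ℓ₁`, of the inverse `Im G → (ker G)ᗮ` of the map induced
by `G`. -/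
def invNorm {r q : ℕ} (G : Matrix (Fin r) (Fin q) ℝ) : ℝ :=
  sSup {t | ∃ y : LinearMap.range (Matrix.toEuclideanLin G),
    vecL1 (y : EuclideanSpace ℝ (Fin r)) ≤ 1 ∧
      t = vecL1 ((inducedEquiv G).symm y : EuclideanSpace ℝ (Fin q))}

/-- The constant `M_G`: the maximum over the layers of the norms of these inverses. -/
def maxInvNorm {L : ℕ} {p m : ℕ → ℕ} (G : RegMatrices L p m) : ℝ :=
  Finset.univ.sup' Finset.univ_nonempty fun l => invNorm (G l)

/-- `‖x‖_n`, the root mean square of the Euclidean norms of the inputs. -/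
def empNorm {n d : ℕ} (x : Fin n → EuclideanSpace ℝ (Fin d)) : ℝ :=
  Real.sqrt ((∑ i, ‖x i‖ ^ 2) / n)

/-- The lower bound for the tuning parameter, as a function of the constant `C`, of `M = M_G`,
of the Lipschitz constant `a`, of `L`, of `s = ‖x‖_n`, of the number `P` of parameters, and
of `n`. -/
def tuningBound (C M a : ℝ) (L : ℕ) (s : ℝ) (P n : ℕ) : ℝ :=
  C * (M + 1) * a ^ (2 * L) * s ^ 2
    * ((Real.sqrt 2 / L) ^ (2 * L - 1) * Real.sqrt (Real.log (2 * P)))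
    * (Real.log (2 * n) / Real.sqrt n)

/-- The closed unit ball of a penalty. -/
def unitBall {L : ℕ} {p : ℕ → ℕ} (h : Params L p → ℝ) : Set (Params L p) := {W | h W ≤ 1}

/-- The regularized empirical risk of `κ • (network W)` for the data `(y i, x i)`. -/
def objective {n L : ℕ} {p : ℕ → ℕ} (hp : p (L + 1) = 1) (f : Activations L p)
    (x : Fin n → EuclideanSpace ℝ (Fin (p 0))) (y : Fin n → ℝ) (lam κ : ℝ) (W : Params L p) : ℝ :=
  1 / n * ∑ i, (y i - κ * network hp f W (x i)) ^ 2 + lam * κ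

/-- `(κ, W)` minimizes the regularized empirical risk over `[0, ∞)` times the unit ball of `h`. -/
def IsEstimator {n L : ℕ} {p : ℕ → ℕ} (hp : p (L + 1) = 1) (f : Activations L p)
    (h : Params L p → ℝ) (x : Fin n → EuclideanSpace ℝ (Fin (p 0))) (y : Fin n → ℝ) (lam : ℝ)
    (κ : ℝ) (W : Params L p) : Prop :=
  0 ≤ κ ∧ W ∈ unitBall h ∧
    ∀ κ' W', 0 ≤ κ' → W' ∈ unitBall h →
      objective hp f x y lam κ W ≤ objective hp f x y lam κ' W'

/-- The squared in-sample prediction error of `κ • (network W)`. -/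
def predErrSq {n L : ℕ} {p : ℕ → ℕ} (hp : p (L + 1) = 1) (f : Activations L p)
    (x : Fin n → EuclideanSpace ℝ (Fin (p 0))) (g : EuclideanSpace ℝ (Fin (p 0)) → ℝ)
    (κ : ℝ) (W : Params L p) : ℝ :=
  1 / n * ∑ i, (g (x i) - κ * network hp f W (x i)) ^ 2

/-- The infimum of `predErrSq + 2 λ κ` over `κ ≥ 0` and `W` in the unit ball of `h`. -/
def oracleBound {n L : ℕ} {p : ℕ → ℕ} (hp : p (L + 1) = 1) (f : Activations L p)
    (h : Params L p → ℝ) (x : Fin n → EuclideanSpace ℝ (Fin (p 0)))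
    (g : EuclideanSpace ℝ (Fin (p 0)) → ℝ) (lam : ℝ) : ℝ :=
  ⨅ q : {q : ℝ × Params L p // 0 ≤ q.1 ∧ q.2 ∈ unitBall h},
    (predErrSq hp f x g q.1.1 q.1.2 + 2 * lam * q.1.1)

/-- Independent, centered, uniformly sub-Gaussian noise with parameters `K` and `γ`. -/
structure SubGaussianNoise {S : Type*} [MeasurableSpace S] (μ : Measure S) {n : ℕ} (K γ : ℝ)
    (u : Fin n → S → ℝ) : Prop where
  measurable : ∀ i, Measurable (u i)
  indep : iIndepFun u μ
  centered : ∀ i, ∫ ω, u i ω ∂μ = 0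
  integrable_exp : ∀ i, Integrable (fun ω => Real.exp (|u i ω| ^ 2 / K ^ 2)) μ
  exp_bound : ∀ i, K ^ 2 * (∫ ω, Real.exp (|u i ω| ^ 2 / K ^ 2) ∂μ - 1) ≤ γ ^ 2

end SparseNet

end

namespace SparseNet

/-! Compare the objective at the estimator `(κ, W)` with its value at a competitor `(κ', V)`. The
noise enters only through `κ` times `2/n * ∑ network * u`. If this sum is at most `λ` in absolute
value on the whole unit ball, the estimator's noise term is paid for by its own penalty `λκ`, and
the competitor's costs a second `λκ'` (`IsEstimator.predErrSq_le_oracleBound`). It remains to bound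
the supremum of the noise process over the `ℓ₁` ball.

On that ball each layer has Frobenius norm at most one, so the network is Lipschitz in its
parameters for the Euclidean distance, with constant `(L + 1) a^L ‖x‖` (`abs_network_sub_le`), and
the process has sub-Gaussian increments. The supremum is bounded by chaining along truncations
toward zero on the grids of mesh `2⁻ᵏ`, with a weighted union bound: an integer code has a product
mass that charges only its nonzero coordinates, each at a cost of order `log (2P) * √|z j|`. A
coordinate `v j` truncates to zero until `2ᵏ` reaches `1/|v j|`, and later contributions decay
geometrically, so its total over all scales is of order `|v j|`. The `ℓ₁` norm thus controls the
whole chain with no further logarithm. The result is of order `√log (2P) * √log (2n)`, the second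
factor coming from the failure probability `1/n` (`exists_forall_abs_le_of_subGaussian_increments`).

The tuning parameter contains a full `log (2n)`. For large `n` the spare `√log (2n)` absorbs the
numerical constants, `L + 1`, the depth factor and the missing power of `a^L ‖x‖_n`
(`noise_le_tuning`), so `C` only carries the sub-Gaussian scale `√(K² + 2γ²)`. -/

/-! ### Sub-Gaussian noise. -/

lemma exp_le_add_exp_sq (x : ℝ) : Real.exp x ≤ x + Real.exp (x ^ 2) := by
  have hq := Real.add_one_le_exp (x ^ 2)
  rcases le_total |x| 1 with h | h
  · have := (abs_le.1 (Real.abs_exp_sub_one_sub_id_le h)).2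
    linarith
  · rcases le_total 0 x with h0 | h0
    · rw [abs_of_nonneg h0] at h
      have : Real.exp x ≤ Real.exp (x ^ 2) := Real.exp_le_exp.2 (by nlinarith)
      linarith
    · rw [abs_of_nonpos h0] at h
      have : Real.exp x ≤ 1 := Real.exp_le_one_iff.2 h0
      nlinarith

/-- Convexity of `exp` between `0` and `y`. -/
lemma exp_mul_le_one_add {r y : ℝ} (h0 : 0 ≤ r) (h1 : r ≤ 1) :
    Real.exp (r * y) ≤ 1 + r * (Real.exp y - 1) := by
  have := convexOn_exp.2 (Set.mem_univ y) (Set.mem_univ (0 : ℝ)) h0 (sub_nonneg.2 h1) (by ring)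
  simp only [smul_eq_mul, mul_zero, add_zero, Real.exp_zero, mul_one] at this
  linarith

/-- A centered random variable with a Gaussian-type exponential moment is sub-Gaussian. -/
lemma hasSubgaussianMGF_of_integral_exp_sq {S : Type*} [MeasurableSpace S] {μ : Measure S}
    [IsProbabilityMeasure μ] {K γ : ℝ} (hK : 0 < K) {X : S → ℝ} (hX : Measurable X)
    (hmean : ∫ ω, X ω ∂μ = 0)
    (hint : Integrable (fun ω => Real.exp (X ω ^ 2 / K ^ 2)) μ)
    (hexp : K ^ 2 * (∫ ω, Real.exp (X ω ^ 2 / K ^ 2) ∂μ - 1) ≤ γ ^ 2) :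
    HasSubgaussianMGF X (Real.toNNReal (K ^ 2 + 2 * γ ^ 2)) μ := by
  have hK2 : 0 < K ^ 2 := by positivity
  have hm : ∫ ω, Real.exp (X ω ^ 2 / K ^ 2) ∂μ ≤ 1 + γ ^ 2 / K ^ 2 := by
    have : ∫ ω, Real.exp (X ω ^ 2 / K ^ 2) ∂μ - 1 ≤ γ ^ 2 / K ^ 2 := by
      rw [le_div_iff₀ hK2]; linarith
    linarith
  have hpt : ∀ t ω : ℝ, Real.exp (t * ω) ≤ Real.exp (t ^ 2 * K ^ 2 / 4) * Real.exp (ω ^ 2 / K ^ 2) := by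
    intro t x
    rw [← Real.exp_add, Real.exp_le_exp]
    have : t ^ 2 * K ^ 2 / 4 + x ^ 2 / K ^ 2 - t * x = (t * K / 2 - x / K) ^ 2 := by
      field_simp; ring
    nlinarith [sq_nonneg (t * K / 2 - x / K)]
  have hXint : Integrable X μ := by
    refine Integrable.mono' (hint.const_mul K) hX.aestronglyMeasurable
      (Filter.Eventually.of_forall fun ω => ?_)
    have h1 := Real.add_one_le_exp (X ω ^ 2 / K ^ 2)
    have h2 : |X ω| ≤ K * (X ω ^ 2 / K ^ 2 + 1) := by
      have h3 : K * (X ω ^ 2 / K ^ 2 + 1) = (|X ω| ^ 2 + K ^ 2) / K := by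
        rw [sq_abs]; field_simp
      rw [h3, le_div_iff₀ hK]
      nlinarith [sq_nonneg (|X ω| - K), sq_nonneg (|X ω|), sq_nonneg K]
    exact h2.trans (mul_le_mul_of_nonneg_left h1 hK.le)
  have hI : ∀ t : ℝ, Integrable (fun ω => Real.exp (t * X ω)) μ := fun t =>
    Integrable.mono' (hint.const_mul (Real.exp (t ^ 2 * K ^ 2 / 4)))
      (by fun_prop) (Filter.Eventually.of_forall fun ω => by
        rw [Real.norm_eq_abs, Real.abs_exp]; exact hpt t (X ω))
  refine ⟨hI, fun t => ?_⟩
  have hc : ((Real.toNNReal (K ^ 2 + 2 * γ ^ 2) : NNReal) : ℝ) = K ^ 2 + 2 * γ ^ 2 :=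
    Real.coe_toNNReal _ (by positivity)
  rw [hc, mgf]
  -- For small `t`, `exp y ≤ y + exp (y²)` removes the linear term by centering, and convexity turns
  -- `exp (t²X²)` into the given moment. For large `t`, Young's inequality `hpt` suffices, because
  -- then `γ²/K² ≤ t²γ²`.
  rcases le_total (t ^ 2 * K ^ 2) 1 with h | h
  · have hle : ∀ ω, Real.exp (t * X ω) ≤
        t * X ω + (1 + t ^ 2 * K ^ 2 * (Real.exp (X ω ^ 2 / K ^ 2) - 1)) := fun ω => by
      have h1 := exp_le_add_exp_sq (t * X ω)
      have h2 := exp_mul_le_one_add (y := X ω ^ 2 / K ^ 2) (by positivity) h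
      have h3 : t ^ 2 * K ^ 2 * (X ω ^ 2 / K ^ 2) = (t * X ω) ^ 2 := by field_simp
      rw [h3] at h2
      linarith
    have hi1 : Integrable (fun ω => t ^ 2 * K ^ 2 * (Real.exp (X ω ^ 2 / K ^ 2) - 1)) μ :=
      (hint.sub (integrable_const 1)).const_mul _
    have hi2 : Integrable (fun ω => 1 + t ^ 2 * K ^ 2 * (Real.exp (X ω ^ 2 / K ^ 2) - 1)) μ :=
      (integrable_const 1).add hi1
    calc ∫ ω, Real.exp (t * X ω) ∂μ
        ≤ ∫ ω, (t * X ω + (1 + t ^ 2 * K ^ 2 * (Real.exp (X ω ^ 2 / K ^ 2) - 1))) ∂μ :=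
          integral_mono (hI t) ((hXint.const_mul t).add hi2) hle
      _ = 1 + t ^ 2 * (K ^ 2 * (∫ ω, Real.exp (X ω ^ 2 / K ^ 2) ∂μ - 1)) := by
          rw [integral_add (hXint.const_mul t) hi2, integral_const_mul, hmean,
            integral_add (integrable_const 1) hi1, integral_const_mul,
            integral_sub hint (integrable_const 1)]
          simp; ring
      _ ≤ 1 + t ^ 2 * γ ^ 2 := by gcongr
      _ ≤ Real.exp (t ^ 2 * γ ^ 2) := by linarith [Real.add_one_le_exp (t ^ 2 * γ ^ 2)]
      _ ≤ _ := Real.exp_le_exp.2 (by nlinarith [mul_nonneg hK2.le (sq_nonneg t)])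
  · calc ∫ ω, Real.exp (t * X ω) ∂μ
        ≤ ∫ ω, Real.exp (t ^ 2 * K ^ 2 / 4) * Real.exp (X ω ^ 2 / K ^ 2) ∂μ :=
          integral_mono (hI t) (hint.const_mul _) fun ω => hpt t (X ω)
      _ = Real.exp (t ^ 2 * K ^ 2 / 4) * ∫ ω, Real.exp (X ω ^ 2 / K ^ 2) ∂μ :=
          integral_const_mul _ _
      _ ≤ Real.exp (t ^ 2 * K ^ 2 / 4) * Real.exp (t ^ 2 * γ ^ 2) := by
          gcongr
          have h4 : γ ^ 2 / K ^ 2 ≤ t ^ 2 * γ ^ 2 := by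
            rw [div_le_iff₀ hK2]; nlinarith [sq_nonneg γ]
          linarith [Real.add_one_le_exp (t ^ 2 * γ ^ 2)]
      _ ≤ _ := by
          rw [← Real.exp_add, Real.exp_le_exp]
          nlinarith [mul_nonneg hK2.le (sq_nonneg t)]

/-- Two-sided tail bound for linear combinations of sub-Gaussian noise variables. -/
lemma SubGaussianNoise.measure_lt_abs_sum_le {S : Type*} [MeasurableSpace S] {μ : Measure S}
    [IsProbabilityMeasure μ] {n : ℕ} {K γ : ℝ} (hK : 0 < K) {u : Fin n → S → ℝ}
    (hu : SubGaussianNoise μ K γ u) (b : Fin n → ℝ) {D : ℝ} (hD : 0 ≤ D)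
    (hb : ∑ i, b i ^ 2 ≤ D ^ 2) {t : ℝ} (ht : 0 ≤ t) :
    μ {ω | Real.sqrt (2 * (K ^ 2 + 2 * γ ^ 2)) * D * Real.sqrt t < |∑ i, b i * u i ω|} ≤
      ENNReal.ofReal (2 * Real.exp (-t)) := by
  set c : ℝ := K ^ 2 + 2 * γ ^ 2 with hc
  have hc0 : 0 < c := by positivity
  set T : ℝ := Real.sqrt (2 * c) * D * Real.sqrt t with hT
  have hT0 : 0 ≤ T := by positivity
  have hsub : ∀ i, HasSubgaussianMGF (u i) (Real.toNNReal c) μ := fun i => by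
    have h1 := hu.integrable_exp i
    have h2 := hu.exp_bound i
    simp only [sq_abs] at h1 h2
    exact hasSubgaussianMGF_of_integral_exp_sq hK (hu.measurable i) (hu.centered i) h1 h2
  -- For `D = 0` the threshold and the sum both vanish, so the event is empty because its inequality
  -- is strict; the Chernoff exponent below needs `D > 0`.
  rcases hD.eq_or_lt with rfl | hDpos
  · have hb0 : ∀ i, b i = 0 := fun i => by
      have h1 : b i ^ 2 ≤ ∑ i, b i ^ 2 :=
        Finset.single_le_sum (f := fun i => b i ^ 2) (fun j _ => sq_nonneg _) (Finset.mem_univ i)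
      exact pow_eq_zero_iff (two_ne_zero) |>.1 (le_antisymm (by linarith) (sq_nonneg _))
    simp [hT, hb0]
  have key : ∀ b' : Fin n → ℝ, ∑ i, b' i ^ 2 ≤ D ^ 2 →
      μ.real {ω | T ≤ ∑ i, b' i * u i ω} ≤ Real.exp (-t) := by
    intro b' hb'
    have hind : iIndepFun (fun i ω => b' i * u i ω) μ :=
      hu.indep.comp (fun i x => b' i * x) fun i => measurable_const_mul _
    have hs := HasSubgaussianMGF.sum_of_iIndepFun hind (s := Finset.univ)
      (fun i _ => (hsub i).const_mul (b' i))
    have hs' : HasSubgaussianMGF (fun ω => ∑ i, b' i * u i ω) (Real.toNNReal (D ^ 2 * c)) μ := by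
      refine ⟨hs.integrable_exp_mul, fun s => (hs.mgf_le s).trans (Real.exp_le_exp.2 ?_)⟩
      rw [Real.coe_toNNReal _ (by positivity)]
      push_cast
      gcongr
      change ∑ i, b' i ^ 2 * (Real.toNNReal c : ℝ) ≤ _
      rw [← Finset.sum_mul, Real.coe_toNNReal _ hc0.le]
      exact mul_le_mul_of_nonneg_right hb' hc0.le
    refine (hs'.measure_ge_le hT0).trans (Real.exp_le_exp.2 ?_)
    rw [Real.coe_toNNReal _ (by positivity), hT, mul_pow, mul_pow, Real.sq_sqrt ht,
      Real.sq_sqrt (by positivity)]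
    apply le_of_eq
    field_simp
  have hsubset : {ω | T < |∑ i, b i * u i ω|} ⊆
      {ω | T ≤ ∑ i, b i * u i ω} ∪ {ω | T ≤ ∑ i, (-b i) * u i ω} := by
    intro ω hω
    simp only [Set.mem_ofPred_eq, Set.mem_union, neg_mul, Finset.sum_neg_distrib] at hω ⊢
    rcases lt_abs.1 hω with h | h
    · exact Or.inl h.le
    · exact Or.inr h.le
  rw [← ENNReal.ofReal_toReal (measure_ne_top μ {ω | T < |∑ i, b i * u i ω|})]
  refine ENNReal.ofReal_le_ofReal ?_
  calc μ.real {ω | T < |∑ i, b i * u i ω|} ≤ _ := measureReal_mono hsubset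
    _ ≤ _ := measureReal_union_le _ _
    _ ≤ Real.exp (-t) + Real.exp (-t) := add_le_add (key b hb) (key (fun i => -b i) (by simpa using hb))
    _ = _ := by ring

/-! ### Truncation to integers and the masses of integer codes. -/

/-- Rounding of a real number to an integer, toward zero. -/
noncomputable def truncInt (x : ℝ) : ℤ := if 0 ≤ x then (⌊x⌋₊ : ℤ) else -(⌊-x⌋₊ : ℤ)

lemma abs_truncInt_le (x : ℝ) : |(truncInt x : ℝ)| ≤ |x| := by
  unfold truncInt
  split_ifs with h
  · rw [abs_of_nonneg h]; simpa using Nat.floor_le h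
  · push Not at h
    rw [abs_of_neg h]; simpa using Nat.floor_le (neg_nonneg.2 h.le)

lemma abs_sub_truncInt_le (x : ℝ) : |x - truncInt x| ≤ 1 := by
  unfold truncInt
  split_ifs with h
  · have h1 := Nat.floor_le h
    have h2 := Nat.lt_floor_add_one x
    rw [abs_le]; push_cast; constructor <;> linarith
  · push Not at h
    have h1 := Nat.floor_le (neg_nonneg.2 h.le)
    have h2 := Nat.lt_floor_add_one (-x)
    rw [abs_le]; push_cast; constructor <;> linarith

/-- Truncation toward zero is compatible with halving, so the coarser code is a function of the
finer one and each link of a chain is indexed by its finer end alone. -/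
lemma truncInt_tdiv_two (y : ℝ) : (truncInt (2 * y)).tdiv 2 = truncInt y := by
  have key : ∀ x : ℝ, ⌊2 * x⌋₊ / 2 = ⌊x⌋₊ := fun x => by
    have := Nat.floor_div_natCast (2 * x) 2
    push_cast at this
    rw [← this]; congr 1; ring
  unfold truncInt
  rcases le_or_gt 0 y with h | h
  · rw [if_pos (by linarith), if_pos h, ← key y]; rfl
  · rw [if_neg (by linarith), if_neg (by linarith), Int.neg_tdiv, ← key (-y), mul_neg]; rfl

lemma truncInt_eq_zero {x : ℝ} (h : |x| < 1) : truncInt x = 0 := by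
  have h1 := (abs_truncInt_le x).trans_lt h
  rw [← Int.cast_abs] at h1
  exact Int.abs_lt_one_iff.1 (by exact_mod_cast h1)

lemma abs_sub_two_mul_tdiv_le (z : ℤ) : |z - 2 * z.tdiv 2| ≤ 1 := by
  rcases le_total 0 z with h | h
  · obtain ⟨m, rfl⟩ := Int.eq_ofNat_of_zero_le h
    have : (m : ℤ).tdiv 2 = ((m / 2 : ℕ) : ℤ) := rfl
    rw [this, abs_le]
    omega
  · obtain ⟨m, hm⟩ := Int.eq_ofNat_of_zero_le (neg_nonneg.2 h)
    obtain rfl : z = -m := by omega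
    have : (m : ℤ).tdiv 2 = ((m / 2 : ℕ) : ℤ) := rfl
    rw [Int.neg_tdiv, this, abs_le]
    omega

lemma two_mul_abs_tdiv_le (z : ℤ) : 2 * |z.tdiv 2| ≤ |z| := by
  rcases le_total 0 z with h | h
  · obtain ⟨m, rfl⟩ := Int.eq_ofNat_of_zero_le h
    have : (m : ℤ).tdiv 2 = ((m / 2 : ℕ) : ℤ) := rfl
    rw [this, abs_of_nonneg (by positivity), abs_of_nonneg (by positivity)]
    omega
  · obtain ⟨m, hm⟩ := Int.eq_ofNat_of_zero_le (neg_nonneg.2 h)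
    obtain rfl : z = -m := by omega
    have : (m : ℤ).tdiv 2 = ((m / 2 : ℕ) : ℤ) := rfl
    rw [Int.neg_tdiv, this, abs_neg, abs_neg, abs_of_nonneg (by positivity),
      abs_of_nonneg (by positivity)]
    omega

/-- The mass given to an integer coordinate, for vectors with `P` coordinates. -/
noncomputable def codeMass (P : ℕ) (z : ℤ) : ℝ :=
  if z = 0 then 1 else 1 / (2 * P * (|(z : ℝ)| * (|(z : ℝ)| + 1)))

lemma codeMass_pos {P : ℕ} (hP : 0 < P) (z : ℤ) : 0 < codeMass P z := by
  unfold codeMass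
  split_ifs with h
  · exact one_pos
  · have : 0 < |(z : ℝ)| := abs_pos.2 (by exact_mod_cast h)
    positivity

/-- The two signs cancel the factor `2`, and `1/(m(m+1))` telescopes. -/
lemma sum_codeMass {P : ℕ} (hP : 0 < P) (M : ℕ) :
    ∑ z ∈ Finset.Icc (-(M : ℤ)) M, codeMass P z = 1 + 1 / P * (1 - 1 / (M + 1)) := by
  induction M with
  | zero => simp [codeMass]
  | succ M ih =>
    have h : Finset.Icc (-((M + 1 : ℕ) : ℤ)) ((M + 1 : ℕ) : ℤ) =
        insert (-((M : ℤ) + 1)) (insert ((M : ℤ) + 1) (Finset.Icc (-(M : ℤ)) M)) := by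
      ext z; simp only [Finset.mem_Icc, Finset.mem_insert]; push_cast; omega
    have h1 : ((M : ℤ) + 1) ∉ Finset.Icc (-(M : ℤ)) M := by simp
    have h2 : (-((M : ℤ) + 1)) ∉ insert ((M : ℤ) + 1) (Finset.Icc (-(M : ℤ)) M) := by
      simp only [Finset.mem_Icc, Finset.mem_insert]; omega
    rw [h, Finset.sum_insert h2, Finset.sum_insert h1, ih]
    have hM : (0 : ℝ) < (M : ℝ) + 1 := by positivity
    have e1 : codeMass P ((M : ℤ) + 1) = 1 / (2 * P * (((M : ℝ) + 1) * ((M : ℝ) + 1 + 1))) := by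
      rw [codeMass, if_neg (by omega)]; push_cast; rw [abs_of_pos hM]
    have e2 : codeMass P (-((M : ℤ) + 1)) =
        1 / (2 * P * (((M : ℝ) + 1) * ((M : ℝ) + 1 + 1))) := by
      rw [codeMass, if_neg (by omega)]; push_cast; rw [abs_neg, abs_of_pos hM]
    rw [e1, e2]
    have hP' : (0 : ℝ) < P := by exact_mod_cast hP
    push_cast
    field_simp
    ring

/-- The sum factorizes over the coordinates and is at most `(1 + 1/P)^P ≤ e`, independently of the
dimension. -/
lemma sum_prod_codeMass_le {ι : Type*} [Fintype ι] [DecidableEq ι] (hι : 0 < Fintype.card ι)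
    (M : ℕ) :
    ∑ z ∈ Fintype.piFinset fun _ : ι => Finset.Icc (-(M : ℤ)) M,
      ∏ j, codeMass (Fintype.card ι) (z j) ≤ 3 := by
  have h := Finset.prod_univ_sum (fun _ : ι => Finset.Icc (-(M : ℤ)) M)
    (fun _ z => codeMass (Fintype.card ι) z)
  rw [← h, Finset.prod_const, sum_codeMass hι, Finset.card_univ]
  have hP : (0 : ℝ) < Fintype.card ι := by exact_mod_cast hι
  calc (1 + 1 / (Fintype.card ι : ℝ) * (1 - 1 / (M + 1))) ^ Fintype.card ι
      ≤ (Real.exp (1 / (Fintype.card ι : ℝ))) ^ Fintype.card ι := by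
        have hM : (0 : ℝ) < 1 / (M + 1) := by positivity
        have hM1 : (1 : ℝ) / (M + 1) ≤ 1 := by
          rw [div_le_one (by positivity)]; linarith [(Nat.cast_nonneg M : (0 : ℝ) ≤ M)]
        have hc : 0 < 1 / (Fintype.card ι : ℝ) := by positivity
        have h0 : 0 ≤ 1 / (Fintype.card ι : ℝ) * (1 - 1 / (M + 1)) :=
          mul_nonneg hc.le (by linarith)
        gcongr
        have := Real.add_one_le_exp (1 / (Fintype.card ι : ℝ))
        nlinarith
    _ = Real.exp 1 := by rw [← Real.exp_nat_mul]; congr 1; field_simp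
    _ ≤ 3 := by linarith [Real.exp_one_lt_d9]

lemma log_le_two_mul_sqrt {x : ℝ} (hx : 0 < x) : Real.log x ≤ 2 * Real.sqrt x := by
  have h := Real.log_le_sub_one_of_pos (Real.sqrt_pos.2 hx)
  rw [Real.log_sqrt hx.le] at h
  linarith

lemma half_le_log_two_mul {m : ℕ} (hm : 0 < m) : 1 / 2 ≤ Real.log (2 * m) := by
  have h1 : Real.log 2 ≤ Real.log (2 * m) := by
    apply Real.log_le_log two_pos
    have : (1 : ℝ) ≤ m := by exact_mod_cast hm
    linarith
  linarith [Real.log_two_gt_d9]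

/-- A zero coordinate costs nothing; otherwise `√|z|` dominates the logarithms of `|z|`. The power
`√|z|` is chosen because it also bounds the squared rounding increment, and `16 = 4²` gives a clean
square root later. -/
lemma neg_log_codeMass_le {P : ℕ} (hP : 0 < P) (z : ℤ) :
    -Real.log (codeMass P z) ≤ 16 * Real.log (2 * P) * Real.sqrt |(z : ℝ)| := by
  have hlog := half_le_log_two_mul hP
  rcases eq_or_ne z 0 with rfl | hz
  · simp [codeMass]
  have hP' : (0 : ℝ) < P := by exact_mod_cast hP
  have hm : (1 : ℝ) ≤ |(z : ℝ)| := by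
    rw [← Int.cast_abs]; exact_mod_cast Int.one_le_abs hz
  set m := |(z : ℝ)|
  have hs : 1 ≤ Real.sqrt m := Real.one_le_sqrt.2 hm
  have e : Real.log (2 * P * (m * (m + 1))) = Real.log (2 * P) + (Real.log m + Real.log (m + 1)) := by
    rw [Real.log_mul (by positivity) (by positivity),
      Real.log_mul (x := m) (by positivity) (by positivity)]
  rw [codeMass, if_neg hz, one_div, Real.log_inv, neg_neg, e]
  have h1 := log_le_two_mul_sqrt (x := m) (by positivity)
  have h2 : Real.log (m + 1) ≤ Real.log (2 * m) := Real.log_le_log (by positivity) (by linarith)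
  rw [Real.log_mul (by norm_num) (by positivity)] at h2
  have h3 := Real.log_two_lt_d9
  have h4 : Real.log (2 * P) + 5 * Real.sqrt m ≤ 16 * Real.log (2 * P) * Real.sqrt m := by
    nlinarith
  linarith

/-! ### Summation over the scales. -/

/-- The square root, cut off below one. -/
noncomputable def cutSqrt (y : ℝ) : ℝ := if y < 1 then 0 else Real.sqrt y

lemma cutSqrt_nonneg (y : ℝ) : 0 ≤ cutSqrt y := by unfold cutSqrt; split_ifs <;> positivity

lemma cutSqrt_le (y : ℝ) : cutSqrt y ≤ Real.sqrt y := by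
  unfold cutSqrt; split_ifs
  · positivity
  · exact le_rfl

lemma sqrt_abs_truncInt_le (x : ℝ) : Real.sqrt |(truncInt x : ℝ)| ≤ cutSqrt |x| := by
  unfold cutSqrt
  split_ifs with h
  · simp [truncInt_eq_zero h]
  · exact Real.sqrt_le_sqrt (abs_truncInt_le x)

lemma sum_cutSqrt_succ (m : ℕ) (x : ℝ) :
    ∑ k ∈ Finset.range (m + 1), cutSqrt (2 ^ k * x) / 2 ^ k =
      cutSqrt x + (∑ k ∈ Finset.range m, cutSqrt (2 ^ k * (2 * x)) / 2 ^ k) / 2 := by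
  rw [Finset.sum_range_succ', add_comm, Finset.sum_div]
  congr 1
  · simp
  · refine Finset.sum_congr rfl fun k _ => ?_
    rw [pow_succ, mul_assoc, div_div]

/-- Splitting off the first term replaces `x` by `2x` and halves the sum; the constant `4` closes
the recursion since `1 + 4√2/2 ≤ 4`. -/
lemma sum_cutSqrt_le_sqrt (m : ℕ) : ∀ x : ℝ, 0 ≤ x →
    ∑ k ∈ Finset.range m, cutSqrt (2 ^ k * x) / 2 ^ k ≤ 4 * Real.sqrt x := by
  induction m with
  | zero => intro x _; simp
  | succ m ih =>
    intro x hx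
    have h := ih (2 * x) (by positivity)
    rw [sum_cutSqrt_succ]
    rw [Real.sqrt_mul (by norm_num)] at h
    have h2 : Real.sqrt 2 ≤ 3 / 2 := by rw [Real.sqrt_le_left (by norm_num)]; norm_num
    nlinarith [cutSqrt_le x, Real.sqrt_nonneg x]

/-- Below one the first term vanishes and the recursion preserves the bound `4x` exactly; from one
on, `√x ≤ x`. This linear bound makes the cost of a chain proportional to the `ℓ₁` norm. -/
lemma sum_cutSqrt_le (m : ℕ) : ∀ x : ℝ, 0 ≤ x →
    ∑ k ∈ Finset.range m, cutSqrt (2 ^ k * x) / 2 ^ k ≤ 4 * x := by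
  induction m with
  | zero => intro x hx; simpa using hx
  | succ m ih =>
    intro x hx
    rcases lt_or_ge x 1 with h | h
    · have := ih (2 * x) (by positivity)
      rw [sum_cutSqrt_succ, cutSqrt, if_pos h]
      linarith
    · refine (sum_cutSqrt_le_sqrt (m + 1) x hx).trans ?_
      have : Real.sqrt x ≤ x := by
        rw [Real.sqrt_le_left (by positivity)]; nlinarith
      linarith

lemma sum_arith_geom_le (m : ℕ) :
    ∑ k ∈ Finset.range m, ((k : ℝ) + 2) * (3 / 4) ^ (k + 1) ≤ 15 - (3 * m + 15) * (3 / 4) ^ m := by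
  induction m with
  | zero => simp
  | succ m ih =>
    rw [Finset.sum_range_succ]
    push_cast
    rw [pow_succ]
    nlinarith [pow_pos (by norm_num : (0 : ℝ) < 3 / 4) m]

/-! ### Chaining over the `ℓ₁` ball along dyadic grids. -/

/-- The point with integer coordinates `z` in units of `2⁻ᵏ`. -/
noncomputable def gridPoint {ι : Type*} (k : ℕ) (z : ι → ℤ) : ι → ℝ := fun j => z j / 2 ^ k

/-- The coordinates on the next coarser grid. -/
def gridParent {ι : Type*} (z : ι → ℤ) : ι → ℤ := fun j => (z j).tdiv 2

/-- The truncation of `x` to the grid with mesh `2⁻ᵏ`. -/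
noncomputable def gridCode {ι : Type*} (k : ℕ) (x : ι → ℝ) : ι → ℤ := fun j => truncInt (2 ^ k * x j)

/-- The mass given to the grid point `z` at level `k + 1`. -/
noncomputable def gridMass {ι : Type*} [Fintype ι] (n k : ℕ) (z : ι → ℤ) : ℝ :=
  (1 / 2) ^ (k + 1) / (6 * n) * ∏ j, codeMass (Fintype.card ι) (z j)

section Grid

variable {ι : Type*}

lemma gridParent_gridCode (k : ℕ) (x : ι → ℝ) : gridParent (gridCode (k + 1) x) = gridCode k x := by
  funext j
  simp only [gridParent, gridCode]
  rw [pow_succ', mul_assoc, truncInt_tdiv_two]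

lemma abs_gridPoint_gridCode_le (k : ℕ) (x : ι → ℝ) (j : ι) :
    |gridPoint k (gridCode k x) j| ≤ |x j| := by
  have h := abs_truncInt_le (2 ^ k * x j)
  have h2 : (0 : ℝ) < 2 ^ k := by positivity
  rw [abs_mul, abs_of_pos h2] at h
  simp only [gridPoint, gridCode]
  rw [abs_div, abs_of_pos h2, div_le_iff₀ h2]
  linarith

lemma abs_gridPoint_gridParent_le (k : ℕ) (z : ι → ℤ) (j : ι) :
    |gridPoint k (gridParent z) j| ≤ |gridPoint (k + 1) z j| := by
  have h : (2 : ℝ) * |((z j).tdiv 2 : ℤ)| ≤ |(z j : ℝ)| := by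
    exact_mod_cast two_mul_abs_tdiv_le (z j)
  have h2 : (0 : ℝ) < 2 ^ k := by positivity
  simp only [gridPoint, gridParent]
  rw [abs_div, abs_div, abs_of_pos h2, abs_of_pos (by positivity : (0 : ℝ) < 2 ^ (k + 1)),
    div_le_div_iff₀ h2 (by positivity), pow_succ]
  rw [Int.cast_abs] at h
  calc _ = 2 * |(((z j).tdiv 2 : ℤ) : ℝ)| * 2 ^ k := by ring
    _ ≤ _ := mul_le_mul_of_nonneg_right h h2.le

lemma tendsto_gridPoint_gridCode (x : ι → ℝ) :
    Filter.Tendsto (fun k => gridPoint k (gridCode k x)) Filter.atTop (nhds x) := by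
  rw [tendsto_pi_nhds]
  intro j
  have h0 : Filter.Tendsto (fun k : ℕ => ((1 : ℝ) / 2) ^ k) Filter.atTop (nhds 0) :=
    tendsto_pow_atTop_nhds_zero_of_lt_one (by norm_num) (by norm_num)
  rw [tendsto_iff_dist_tendsto_zero]
  refine squeeze_zero (fun _ => dist_nonneg) (fun k => ?_) h0
  have h := abs_sub_truncInt_le (2 ^ k * x j)
  have h2 : (0 : ℝ) < 2 ^ k := by positivity
  simp only [gridPoint, gridCode]
  rw [dist_comm, Real.dist_eq]
  have e : x j - (truncInt (2 ^ k * x j) : ℝ) / 2 ^ k =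
      (2 ^ k * x j - truncInt (2 ^ k * x j)) / 2 ^ k := by field_simp
  rw [e, abs_div, abs_of_pos h2, one_div, inv_pow, ← one_div]
  gcongr

variable [Fintype ι]

lemma gridMass_pos (hι : 0 < Fintype.card ι) {n : ℕ} (hn : 0 < n) (k : ℕ) (z : ι → ℤ) :
    0 < gridMass n k z := by
  have : (0 : ℝ) < n := by exact_mod_cast hn
  exact mul_pos (by positivity) (Finset.prod_pos fun j _ => codeMass_pos hι _)

lemma neg_log_gridMass_le (hι : 0 < Fintype.card ι) {n : ℕ} (hn : 0 < n) (k : ℕ) (z : ι → ℤ) :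
    -Real.log (gridMass n k z) ≤
      16 * Real.log (2 * Fintype.card ι) * ∑ j, Real.sqrt |(z j : ℝ)| +
        (k + 2) ^ 2 * Real.log (6 * n) := by
  have hn1 : (1 : ℝ) ≤ n := by exact_mod_cast hn
  have h1 : ∀ j, codeMass (Fintype.card ι) (z j) ≠ 0 := fun j => (codeMass_pos hι _).ne'
  have hl : Real.log 2 ≤ Real.log (6 * n) := Real.log_le_log two_pos (by linarith)
  have hl0 : 0 < Real.log 2 := Real.log_pos one_lt_two
  have hs : ∑ j, -Real.log (codeMass (Fintype.card ι) (z j)) ≤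
      ∑ j, 16 * Real.log (2 * Fintype.card ι) * Real.sqrt |(z j : ℝ)| :=
    Finset.sum_le_sum fun j _ => neg_log_codeMass_le hι (z j)
  rw [Finset.sum_neg_distrib, ← Finset.mul_sum] at hs
  rw [gridMass, Real.log_mul (by positivity) (Finset.prod_ne_zero_iff.2 fun j _ => h1 j),
    Real.log_prod (fun j _ => h1 j), Real.log_div (by positivity) (by positivity), Real.log_pow,
    one_div, Real.log_inv]
  have hk : (0 : ℝ) ≤ k := Nat.cast_nonneg k
  have h2 : ((k : ℝ) + 1) * Real.log 2 ≤ (k + 1) * Real.log (6 * n) := by gcongr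
  push_cast
  nlinarith [mul_nonneg (mul_nonneg hk hk) (hl0.le.trans hl), mul_nonneg hk (hl0.le.trans hl)]

/-- In units of `1/q`, with `q = 2^(k+1)`, the squared increment `D` is at most both `∑ √|z j|` and
`q`. The first bound is paired with the coordinate cost, the second with the cost of the level and
of the failure probability, which then decays like `√q/q`. -/
lemma grid_increment_le (hι : 0 < Fintype.card ι) {n : ℕ} (hn : 0 < n) (k : ℕ) (z : ι → ℤ)
    (hz : ∑ j, |gridPoint (k + 1) z j| ≤ 1 / 2) :
    Real.sqrt (∑ j, (gridPoint (k + 1) z j - gridPoint k (gridParent z) j) ^ 2) *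
        Real.sqrt (-Real.log (gridMass n k z)) ≤
      4 * Real.sqrt (Real.log (2 * Fintype.card ι)) * (∑ j, Real.sqrt |(z j : ℝ)| / 2 ^ (k + 1)) +
        ((k + 2) * (3 / 4) ^ (k + 1)) * Real.sqrt (Real.log (6 * n)) := by
  set l := Real.log (2 * Fintype.card ι)
  set A := Real.log (6 * n)
  set q : ℝ := 2 ^ (k + 1) with hq
  have hq0 : 0 < q := by positivity
  have hl0 : 0 ≤ l := le_trans (by norm_num) (half_le_log_two_mul hι)
  have hn1 : (1 : ℝ) ≤ n := by exact_mod_cast hn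
  have hA0 : 0 ≤ A := Real.log_nonneg (by linarith)
  set β : ℝ := ∑ j, Real.sqrt |(z j : ℝ)| with hβ
  have hβ0 : 0 ≤ β := Finset.sum_nonneg fun j _ => Real.sqrt_nonneg _
  set D : ℝ := ∑ j, ((z j : ℝ) - 2 * ((z j).tdiv 2 : ℤ)) ^ 2 with hD
  -- A zero code has zero increment; any other code has increment at most one while `|w| ≥ 1`.
  have hterm : ∀ w : ℤ, ((w : ℝ) - 2 * (w.tdiv 2 : ℤ)) ^ 2 ≤ Real.sqrt |(w : ℝ)| ∧
      ((w : ℝ) - 2 * (w.tdiv 2 : ℤ)) ^ 2 ≤ |(w : ℝ)| := by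
    intro w
    rcases eq_or_ne w 0 with rfl | hw
    · simp
    have h1 : (1 : ℝ) ≤ |(w : ℝ)| := by rw [← Int.cast_abs]; exact_mod_cast Int.one_le_abs hw
    have h2 : |(w : ℝ) - 2 * (w.tdiv 2 : ℤ)| ≤ 1 := by
      exact_mod_cast abs_sub_two_mul_tdiv_le w
    have h3 : ((w : ℝ) - 2 * (w.tdiv 2 : ℤ)) ^ 2 ≤ 1 := by
      rw [← sq_abs]; exact pow_le_one₀ (abs_nonneg _) h2
    exact ⟨h3.trans (Real.one_le_sqrt.2 h1), h3.trans h1⟩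
  have hDβ : D ≤ β := Finset.sum_le_sum fun j _ => (hterm (z j)).1
  have hDq : D ≤ q := by
    have h1 : D ≤ ∑ j, |(z j : ℝ)| := Finset.sum_le_sum fun j _ => (hterm (z j)).2
    have h2 : ∑ j, |gridPoint (k + 1) z j| = (∑ j, |(z j : ℝ)|) / q := by
      rw [Finset.sum_div]
      refine Finset.sum_congr rfl fun j _ => ?_
      rw [gridPoint, abs_div, abs_of_pos hq0]
    rw [h2, div_le_iff₀ hq0] at hz
    linarith
  have hdiff : ∑ j, (gridPoint (k + 1) z j - gridPoint k (gridParent z) j) ^ 2 = D / q ^ 2 := by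
    rw [hD, Finset.sum_div]
    refine Finset.sum_congr rfl fun j _ => ?_
    simp only [gridPoint, gridParent, hq]
    field_simp
    ring
  -- The ratio `3/4` replaces `1/√2`, as `1/2 ≤ (3/4)²`.
  have hqr : Real.sqrt q / q ≤ (3 / 4) ^ (k + 1) := by
    have h2 : Real.sqrt q / q = Real.sqrt (1 / q) := by
      rw [Real.sqrt_div_self', ← Real.sqrt_one, ← Real.sqrt_div zero_le_one, Real.sqrt_one]
    rw [h2, Real.sqrt_le_left (by positivity), ← pow_mul, mul_comm (k + 1) 2, pow_mul, hq,
      ← one_div_pow]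
    gcongr
    norm_num
  have hlog := neg_log_gridMass_le hι hn k z
  have hsq : Real.sqrt (-Real.log (gridMass n k z)) ≤
      4 * Real.sqrt l * Real.sqrt β + (k + 2) * Real.sqrt A := by
    rw [Real.sqrt_le_left (by positivity)]
    refine hlog.trans ?_
    have e1 : Real.sqrt l ^ 2 = l := Real.sq_sqrt hl0
    have e2 : Real.sqrt β ^ 2 = β := Real.sq_sqrt hβ0
    have e3 : Real.sqrt A ^ 2 = A := Real.sq_sqrt hA0
    have e4 : 0 ≤ 2 * (4 * Real.sqrt l * Real.sqrt β) * ((k + 2) * Real.sqrt A) := by positivity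
    calc 16 * l * β + (k + 2) ^ 2 * A
        = 16 * Real.sqrt l ^ 2 * Real.sqrt β ^ 2 + (k + 2) ^ 2 * Real.sqrt A ^ 2 := by
          rw [e1, e2, e3]
      _ ≤ _ := by nlinarith
  rw [hdiff, Real.sqrt_div' _ (sq_nonneg q), Real.sqrt_sq hq0.le, ← Finset.sum_div]
  have hb1 : Real.sqrt D * Real.sqrt β ≤ β := by
    calc Real.sqrt D * Real.sqrt β ≤ Real.sqrt β * Real.sqrt β := by gcongr
      _ = β := Real.mul_self_sqrt hβ0
  calc Real.sqrt D / q * Real.sqrt (-Real.log (gridMass n k z))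
      ≤ Real.sqrt D / q * (4 * Real.sqrt l * Real.sqrt β + (k + 2) * Real.sqrt A) := by gcongr
    _ = 4 * Real.sqrt l * (Real.sqrt D * Real.sqrt β / q) +
        ((k + 2) * (Real.sqrt D / q)) * Real.sqrt A := by ring
    _ ≤ 4 * Real.sqrt l * (β / q) + ((k + 2) * (3 / 4) ^ (k + 1)) * Real.sqrt A := by
        have : Real.sqrt D / q ≤ (3 / 4) ^ (k + 1) :=
          le_trans (by gcongr) hqr
        gcongr

lemma sum_grid_increment_le (hι : 0 < Fintype.card ι) {n : ℕ} (hn : 0 < n) (m : ℕ) (x : ι → ℝ)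
    (hx : ∑ j, |x j| ≤ 1 / 2) :
    ∑ k ∈ Finset.range m,
      (4 * Real.sqrt (Real.log (2 * Fintype.card ι)) *
          (∑ j, Real.sqrt |(gridCode (k + 1) x j : ℝ)| / 2 ^ (k + 1)) +
        ((k + 2) * (3 / 4) ^ (k + 1)) * Real.sqrt (Real.log (6 * n))) ≤
      76 * Real.sqrt (Real.log (2 * Fintype.card ι)) * Real.sqrt (Real.log (2 * n)) := by
  have hl := half_le_log_two_mul hι
  have hA := half_le_log_two_mul hn
  have hn1 : (1 : ℝ) ≤ n := by exact_mod_cast hn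
  have h6 : Real.log (6 * n) ≤ 4 * Real.log (2 * n) := by
    rw [show (4 : ℝ) * Real.log (2 * n) = Real.log ((2 * n) ^ 4) by rw [Real.log_pow]; norm_num]
    apply Real.log_le_log (by positivity)
    have : (1 : ℝ) ≤ n ^ 3 := one_le_pow₀ hn1
    nlinarith
  set l := Real.log (2 * Fintype.card ι)
  set A := Real.log (2 * n)
  have hs6 : Real.sqrt (Real.log (6 * n)) ≤ 2 * Real.sqrt A := by
    rw [Real.sqrt_le_left (by positivity), mul_pow, Real.sq_sqrt (by linarith)]
    linarith
  have h1 : ∑ k ∈ Finset.range m, ∑ j, Real.sqrt |(gridCode (k + 1) x j : ℝ)| / 2 ^ (k + 1) ≤ 2 := by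
    rw [Finset.sum_comm]
    calc ∑ j, ∑ k ∈ Finset.range m, Real.sqrt |(gridCode (k + 1) x j : ℝ)| / 2 ^ (k + 1)
        ≤ ∑ j, ∑ k ∈ Finset.range (m + 1), cutSqrt (2 ^ k * |x j|) / 2 ^ k := by
          refine Finset.sum_le_sum fun j _ => ?_
          rw [Finset.sum_range_succ']
          refine le_trans (Finset.sum_le_sum fun k _ => ?_)
            (le_add_of_nonneg_right (by have := cutSqrt_nonneg (2 ^ 0 * |x j|); positivity))
          have := sqrt_abs_truncInt_le (2 ^ (k + 1) * x j)
          rw [abs_mul, abs_of_pos (by positivity : (0 : ℝ) < 2 ^ (k + 1))] at this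
          exact div_le_div_of_nonneg_right this (by positivity)
      _ ≤ ∑ j, 4 * |x j| := Finset.sum_le_sum fun j _ => sum_cutSqrt_le _ _ (abs_nonneg _)
      _ ≤ 2 := by rw [← Finset.mul_sum]; linarith
  have h2 : ∑ k ∈ Finset.range m, ((k : ℝ) + 2) * (3 / 4) ^ (k + 1) ≤ 15 := by
    have h := sum_arith_geom_le m
    have : (0 : ℝ) ≤ (3 * m + 15) * (3 / 4) ^ m := by positivity
    linarith
  have hsl : 1 / 2 ≤ Real.sqrt l := Real.le_sqrt_of_sq_le (by linarith)
  have hsA : 1 / 2 ≤ Real.sqrt A := Real.le_sqrt_of_sq_le (by linarith)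
  rw [Finset.sum_add_distrib, ← Finset.mul_sum, ← Finset.sum_mul]
  -- Both roots are at least `1/2`, so `8√l + 30√A ≤ (16 + 60) √l √A`; hence `76`.
  calc _ ≤ 4 * Real.sqrt l * 2 + 15 * (2 * Real.sqrt A) := by gcongr
    _ ≤ _ := by nlinarith

/-- Uniform control, over an `ℓ₁` ball, of a process with sub-Gaussian increments with respect to
the Euclidean distance. -/
theorem exists_forall_abs_le_of_subGaussian_increments (hι : 0 < Fintype.card ι)
    {S : Type*} [MeasurableSpace S] {μ : Measure S} [IsProbabilityMeasure μ]
    (X : (ι → ℝ) → S → ℝ) (hmeas : ∀ v, Measurable (X v))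
    (hcont : ∀ ω, Continuous fun v => X v ω) (hzero : ∀ ω, X 0 ω = 0)
    {ρ : ℝ} (hρ : 0 ≤ ρ)
    (htail : ∀ v w : ι → ℝ, ∑ j, |v j| ≤ 1 / 2 → ∑ j, |w j| ≤ 1 / 2 → ∀ t : ℝ, 0 ≤ t →
      μ {ω | ρ * Real.sqrt (∑ j, (v j - w j) ^ 2) * Real.sqrt t < |X v ω - X w ω|} ≤
        ENNReal.ofReal (2 * Real.exp (-t)))
    {n : ℕ} (hn : 0 < n) :
    ∃ E : Set S, MeasurableSet E ∧ ENNReal.ofReal (1 - 1 / n) ≤ μ E ∧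
      ∀ ω ∈ E, ∀ v : ι → ℝ, ∑ j, |v j| ≤ 1 / 2 →
        |X v ω| ≤ ρ * (76 * Real.sqrt (Real.log (2 * Fintype.card ι)) *
          Real.sqrt (Real.log (2 * n))) := by
  classical
  have hn0 : (0 : ℝ) < n := by exact_mod_cast hn
  -- A finite product set containing the codes of every point of the ball, on which the masses
  -- factorize.
  let box : ℕ → Finset (ι → ℤ) := fun k =>
    (Fintype.piFinset fun _ : ι => Finset.Icc (-((2 ^ (k + 1) : ℕ) : ℤ)) ((2 ^ (k + 1) : ℕ) : ℤ))
  let ball : ℕ → Finset (ι → ℤ) := fun k =>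
    (box k).filter fun z => ∑ j, |gridPoint (k + 1) z j| ≤ 1 / 2
  let bad : ℕ → (ι → ℤ) → Set S := fun k z => {ω |
    ρ * Real.sqrt (∑ j, (gridPoint (k + 1) z j - gridPoint k (gridParent z) j) ^ 2) *
      Real.sqrt (-Real.log (gridMass n k z)) <
        |X (gridPoint (k + 1) z) ω - X (gridPoint k (gridParent z)) ω|}
  have hbadmeas : ∀ k z, MeasurableSet (bad k z) := fun k z =>
    measurableSet_lt measurable_const ((hmeas _).sub (hmeas _)).abs
  let B : Set S := ⋃ k, ⋃ z ∈ ball k, bad k z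
  have hBmeas : MeasurableSet B :=
    MeasurableSet.iUnion fun k => Finset.measurableSet_biUnion _ fun z _ => hbadmeas k z
  have hmass1 : ∀ k, ∑ z ∈ box k, gridMass n k z ≤ (1 / 2) ^ (k + 1) / (2 * n) := by
    intro k
    simp only [gridMass]
    rw [← Finset.mul_sum]
    have := sum_prod_codeMass_le hι (2 ^ (k + 1))
    calc _ ≤ (1 / 2 : ℝ) ^ (k + 1) / (6 * n) * 3 := by gcongr
      _ = _ := by field_simp; norm_num
  have hmassle : ∀ k, ∀ z ∈ box k, gridMass n k z ≤ 1 := by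
    intro k z hz
    have h1 := Finset.single_le_sum (f := fun z => gridMass n k z)
      (fun z _ => (gridMass_pos hι hn k z).le) hz
    refine (h1.trans (hmass1 k)).trans ?_
    have hn1 : (1 : ℝ) ≤ n := by exact_mod_cast hn
    rw [div_le_one (by positivity)]
    have : (1 / 2 : ℝ) ^ (k + 1) ≤ 1 := pow_le_one₀ (by norm_num) (by norm_num)
    linarith
  -- Taking `t = -log (mass)` in the tail bound makes each bad event cost twice its mass, and the
  -- levels then sum to `1/n`.
  have hlevel : ∀ k, μ (⋃ z ∈ ball k, bad k z) ≤ ENNReal.ofReal (1 / n / 2 / 2 ^ k) := by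
    intro k
    calc μ (⋃ z ∈ ball k, bad k z) ≤ ∑ z ∈ ball k, μ (bad k z) := measure_biUnion_finset_le _ _
      _ ≤ ∑ z ∈ ball k, ENNReal.ofReal (2 * gridMass n k z) := by
          refine Finset.sum_le_sum fun z hz => ?_
          obtain ⟨hz1, hz2⟩ := Finset.mem_filter.1 hz
          have h := htail (gridPoint (k + 1) z) (gridPoint k (gridParent z)) hz2
            ((Finset.sum_le_sum fun j _ => abs_gridPoint_gridParent_le k z j).trans hz2)
            (-Real.log (gridMass n k z))
            (neg_nonneg.2 (Real.log_nonpos (gridMass_pos hι hn k z).le (hmassle k z hz1)))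
          rwa [neg_neg, Real.exp_log (gridMass_pos hι hn k z)] at h
      _ = ENNReal.ofReal (∑ z ∈ ball k, 2 * gridMass n k z) :=
          (ENNReal.ofReal_sum_of_nonneg fun z _ =>
            mul_nonneg two_pos.le (gridMass_pos hι hn k z).le).symm
      _ ≤ _ := by
          apply ENNReal.ofReal_le_ofReal
          rw [← Finset.mul_sum]
          calc 2 * ∑ z ∈ ball k, gridMass n k z ≤ 2 * ∑ z ∈ box k, gridMass n k z := by
                gcongr
                · exact fun z _ _ => (gridMass_pos hι hn k z).le
                · exact Finset.filter_subset _ _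
            _ ≤ 2 * ((1 / 2) ^ (k + 1) / (2 * n)) := by gcongr; exact hmass1 k
            _ = _ := by rw [one_div_pow, pow_succ]; field_simp
  have hμB : μ B ≤ ENNReal.ofReal (1 / n) := by
    calc μ B ≤ ∑' k, μ (⋃ z ∈ ball k, bad k z) := measure_iUnion_le _
      _ ≤ ∑' k, ENNReal.ofReal (1 / n / 2 / 2 ^ k) := ENNReal.tsum_le_tsum hlevel
      _ = ENNReal.ofReal (1 / n) := by
          rw [← ENNReal.ofReal_tsum_of_nonneg (fun k => by positivity) (summable_geometric_two' _),
            tsum_geometric_two']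
  refine ⟨Bᶜ, hBmeas.compl, ?_, ?_⟩
  · rw [prob_compl_eq_one_sub hBmeas, ENNReal.ofReal_sub _ (by positivity), ENNReal.ofReal_one]
    exact tsub_le_tsub_left hμB 1
  intro ω hω v hv
  have hgrid : ∀ k, ∑ j, |gridPoint k (gridCode k v) j| ≤ 1 / 2 := fun k =>
    (Finset.sum_le_sum fun j _ => abs_gridPoint_gridCode_le k v j).trans hv
  have hcoord : ∀ j, |v j| ≤ 1 / 2 := fun j =>
    (Finset.single_le_sum (f := fun j => |v j|) (fun j _ => abs_nonneg _) (Finset.mem_univ j)).trans hv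
  have hstep : ∀ k, |X (gridPoint (k + 1) (gridCode (k + 1) v)) ω - X (gridPoint k (gridCode k v)) ω| ≤
      ρ * (4 * Real.sqrt (Real.log (2 * Fintype.card ι)) *
          (∑ j, Real.sqrt |(gridCode (k + 1) v j : ℝ)| / 2 ^ (k + 1)) +
        ((k + 2) * (3 / 4) ^ (k + 1)) * Real.sqrt (Real.log (6 * n))) := by
    intro k
    have hmem : gridCode (k + 1) v ∈ ball k := by
      refine Finset.mem_filter.2 ⟨Fintype.mem_piFinset.2 fun j => ?_, hgrid (k + 1)⟩
      have h1 := abs_truncInt_le (2 ^ (k + 1) * v j)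
      have hp : (0 : ℝ) < 2 ^ (k + 1) := by positivity
      rw [abs_mul, abs_of_pos hp] at h1
      have h2 : |(gridCode (k + 1) v j : ℝ)| ≤ 2 ^ (k + 1) := by
        refine h1.trans ?_
        nlinarith [hcoord j]
      rw [Finset.mem_Icc, ← abs_le]
      exact_mod_cast h2
    have hnot : ω ∉ bad k (gridCode (k + 1) v) := fun h =>
      hω (Set.mem_iUnion.2 ⟨k, Set.mem_biUnion hmem h⟩)
    simp only [bad, Set.mem_ofPred_eq, not_lt] at hnot
    rw [gridParent_gridCode] at hnot
    refine hnot.trans ?_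
    rw [mul_assoc]
    have hi := grid_increment_le hι hn k (gridCode (k + 1) v) (hgrid (k + 1))
    rw [gridParent_gridCode] at hi
    exact mul_le_mul_of_nonneg_left hi hρ
  -- Radius `1/2`, rather than `1`, makes every chain start at the origin.
  have hstart : X (gridPoint 0 (gridCode 0 v)) ω = 0 := by
    have : gridPoint 0 (gridCode 0 v) = 0 := by
      funext j
      have : |2 ^ 0 * v j| < 1 := by
        rw [pow_zero, one_mul]; linarith [hcoord j]
      simp [gridPoint, gridCode, truncInt_eq_zero (by simpa using this)]
    rw [this, hzero]
  have hbound : ∀ m, |X (gridPoint m (gridCode m v)) ω| ≤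
      ρ * (76 * Real.sqrt (Real.log (2 * Fintype.card ι)) * Real.sqrt (Real.log (2 * n))) := by
    intro m
    have htel := Finset.sum_range_sub (fun k => X (gridPoint k (gridCode k v)) ω) m
    simp only [hstart, sub_zero] at htel
    rw [← htel]
    refine (Finset.abs_sum_le_sum_abs _ _).trans ?_
    refine (Finset.sum_le_sum fun k _ => hstep k).trans ?_
    rw [← Finset.mul_sum]
    exact mul_le_mul_of_nonneg_left (sum_grid_increment_le hι hn m v hv) hρ
  have hlim := (((hcont ω).tendsto v).comp (tendsto_gridPoint_gridCode v)).abs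
  exact le_of_tendsto hlim (Filter.Eventually.of_forall hbound)

end Grid

/-! ### Lipschitz dependence of networks on their parameters. -/

/-- The Frobenius norm of a matrix. -/
noncomputable def frobNorm {r c : ℕ} (A : Matrix (Fin r) (Fin c) ℝ) : ℝ :=
  Real.sqrt (∑ i, ∑ j, A i j ^ 2)

lemma frobNorm_nonneg {r c : ℕ} (A : Matrix (Fin r) (Fin c) ℝ) : 0 ≤ frobNorm A :=
  Real.sqrt_nonneg _

lemma norm_toEuclideanLin_le {r c : ℕ} (A : Matrix (Fin r) (Fin c) ℝ)
    (x : EuclideanSpace ℝ (Fin c)) : ‖Matrix.toEuclideanLin A x‖ ≤ frobNorm A * ‖x‖ := by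
  have h0 : 0 ≤ ∑ i, ∑ j, A i j ^ 2 :=
    Finset.sum_nonneg fun i _ => Finset.sum_nonneg fun j _ => sq_nonneg (A i j)
  rw [EuclideanSpace.norm_eq, EuclideanSpace.norm_eq, frobNorm, ← Real.sqrt_mul h0]
  apply Real.sqrt_le_sqrt
  rw [Finset.sum_mul]
  refine Finset.sum_le_sum fun i _ => ?_
  simp only [Real.norm_eq_abs, sq_abs]
  have h : (Matrix.toEuclideanLin A x) i = ∑ j, A i j * x j := rfl
  rw [h]
  exact Finset.sum_mul_sq_le_sq_mul_sq _ _ _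

lemma matrixL1_nonneg {r c : ℕ} (A : Matrix (Fin r) (Fin c) ℝ) : 0 ≤ matrixL1 A :=
  Finset.sum_nonneg fun _ _ => Finset.sum_nonneg fun _ _ => abs_nonneg _

lemma frobNorm_le_matrixL1 {r c : ℕ} (A : Matrix (Fin r) (Fin c) ℝ) :
    frobNorm A ≤ matrixL1 A := by
  have h : ∑ i, ∑ j, A i j ^ 2 ≤ (∑ i, ∑ j, |A i j|) ^ 2 := by
    rw [← Finset.sum_product', ← Finset.sum_product']
    simp_rw [← sq_abs (A _ _)]
    exact Finset.sum_sq_le_sq_sum_of_nonneg fun _ _ => abs_nonneg _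
  exact (Real.sqrt_le_sqrt h).trans_eq (Real.sqrt_sq (matrixL1_nonneg A))

/-- The positions of the entries of the parameters. -/
abbrev ParamIndex (L : ℕ) (p : ℕ → ℕ) : Type :=
  (l : Fin (L + 1)) × (Fin (p (l + 1)) × Fin (p l))

/-- The parameters with a given vector of entries. -/
def toParams {L : ℕ} {p : ℕ → ℕ} (v : ParamIndex L p → ℝ) : Params L p :=
  fun l => Matrix.of fun i j => v ⟨l, i, j⟩

/-- The vector of entries of the parameters. -/
def ofParams {L : ℕ} {p : ℕ → ℕ} (W : Params L p) : ParamIndex L p → ℝ :=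
  fun q => W q.1 q.2.1 q.2.2

lemma toParams_ofParams {L : ℕ} {p : ℕ → ℕ} (W : Params L p) : toParams (ofParams W) = W := rfl

lemma card_paramIndex (L : ℕ) (p : ℕ → ℕ) : Fintype.card (ParamIndex L p) = numParams L p := by
  simp [numParams, Fintype.card_sigma]

lemma l1Penalty_toParams {L : ℕ} {p : ℕ → ℕ} (v : ParamIndex L p → ℝ) :
    l1Penalty (toParams v) = ∑ q, |v q| := by
  rw [Fintype.sum_sigma, l1Penalty]
  refine Finset.sum_congr rfl fun l _ => ?_
  rw [Fintype.sum_prod_type]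
  rfl

lemma frobNorm_le_one {L : ℕ} {p : ℕ → ℕ} {W : Params L p} (hW : l1Penalty W ≤ 1)
    (l : Fin (L + 1)) : frobNorm (W l) ≤ 1 :=
  (frobNorm_le_matrixL1 _).trans ((Finset.single_le_sum (f := fun l => matrixL1 (W l))
    (fun _ _ => matrixL1_nonneg _) (Finset.mem_univ l)).trans hW)

lemma frobNorm_toParams_sub_le {L : ℕ} {p : ℕ → ℕ} (v w : ParamIndex L p → ℝ) (l : Fin (L + 1)) :
    frobNorm (toParams v l - toParams w l) ≤ Real.sqrt (∑ q, (v q - w q) ^ 2) := by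
  apply Real.sqrt_le_sqrt
  rw [Fintype.sum_sigma]
  refine le_trans (le_of_eq ?_) (Finset.single_le_sum
    (f := fun l : Fin (L + 1) => ∑ y : Fin (p (l + 1)) × Fin (p l), (v ⟨l, y⟩ - w ⟨l, y⟩) ^ 2)
    (fun _ _ => Finset.sum_nonneg fun _ _ => sq_nonneg _) (Finset.mem_univ l))
  rw [Fintype.sum_prod_type]
  rfl

section Network

variable {L : ℕ} {p : ℕ → ℕ} {a : ℝ} {f : Activations L p}

lemma Admissible.norm_le (hf : Admissible a f) (l : Fin L) (z : EuclideanSpace ℝ (Fin (p (l + 1)))) :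
    ‖f l z‖ ≤ a * ‖z‖ := by
  simpa [hf.map_zero] using hf.lipschitz l z 0

lemma norm_preactivation_le (ha : 0 ≤ a) (hf : Admissible a f) {W : Params L p}
    (hW : ∀ l, frobNorm (W l) ≤ 1) (x : EuclideanSpace ℝ (Fin (p 0))) (l : ℕ) (hl : l < L + 1) :
    ‖preactivation f W x l hl‖ ≤ a ^ l * ‖x‖ := by
  induction l with
  | zero =>
    rw [preactivation]
    refine (norm_toEuclideanLin_le _ _).trans ?_
    rw [pow_zero]
    exact mul_le_mul_of_nonneg_right (hW _) (norm_nonneg _)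
  | succ l ih =>
    rw [preactivation]
    refine (norm_toEuclideanLin_le _ _).trans ?_
    refine (mul_le_of_le_one_left (norm_nonneg _) (hW _)).trans ?_
    refine (hf.norm_le _ _).trans ?_
    rw [pow_succ', mul_assoc]
    exact mul_le_mul_of_nonneg_left (ih _) ha

/-- Changing one layer at a time costs `δ` per layer, since all remaining layers have norm at most
one; `l + 1` counts the layers. -/
lemma norm_preactivation_sub_le (ha : 0 ≤ a) (hf : Admissible a f) {W V : Params L p}
    (hW : ∀ l, frobNorm (W l) ≤ 1) (hV : ∀ l, frobNorm (V l) ≤ 1) {δ : ℝ}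
    (hWV : ∀ l, frobNorm (W l - V l) ≤ δ)
    (x : EuclideanSpace ℝ (Fin (p 0))) (l : ℕ) (hl : l < L + 1) :
    ‖preactivation f W x l hl - preactivation f V x l hl‖ ≤ a ^ l * ‖x‖ * ((l + 1) * δ) := by
  have hδ : 0 ≤ δ := (frobNorm_nonneg _).trans (hWV 0)
  induction l with
  | zero =>
    rw [preactivation, preactivation, ← LinearMap.sub_apply, ← map_sub]
    refine (norm_toEuclideanLin_le _ _).trans ?_
    refine (mul_le_mul_of_nonneg_right (hWV _) (norm_nonneg _)).trans_eq ?_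
    push_cast
    ring
  | succ l ih =>
    rw [preactivation, preactivation]
    set y := preactivation f W x l (Nat.lt_of_succ_lt hl)
    set z := preactivation f V x l (Nat.lt_of_succ_lt hl)
    have hz : ‖z‖ ≤ a ^ l * ‖x‖ := norm_preactivation_le ha hf hV x l _
    have e : ∀ (A B : Matrix (Fin (p (l + 1 + 1))) (Fin (p (l + 1))) ℝ)
        (b c : EuclideanSpace ℝ (Fin (p (l + 1)))),
        Matrix.toEuclideanLin A b - Matrix.toEuclideanLin B c =
          Matrix.toEuclideanLin A (b - c) + Matrix.toEuclideanLin (A - B) c := by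
      intro A B b c
      rw [map_sub, map_sub, LinearMap.sub_apply]
      abel
    rw [e]
    refine (norm_add_le _ _).trans ?_
    have h1 := (norm_toEuclideanLin_le (W ⟨l + 1, hl⟩)
      (f ⟨l, Nat.lt_of_succ_lt_succ hl⟩ y - f ⟨l, Nat.lt_of_succ_lt_succ hl⟩ z)).trans
      (mul_le_of_le_one_left (norm_nonneg _) (hW _))
    have h2 := h1.trans (hf.lipschitz ⟨l, Nat.lt_of_succ_lt_succ hl⟩ y z)
    have h3 := h2.trans (mul_le_mul_of_nonneg_left (ih _) ha)
    have h4 := norm_toEuclideanLin_le (W ⟨l + 1, hl⟩ - V ⟨l + 1, hl⟩)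
      (f ⟨l, Nat.lt_of_succ_lt_succ hl⟩ z)
    have h5 : ‖f ⟨l, Nat.lt_of_succ_lt_succ hl⟩ z‖ ≤ a * (a ^ l * ‖x‖) :=
      (hf.norm_le ⟨l, Nat.lt_of_succ_lt_succ hl⟩ z).trans (mul_le_mul_of_nonneg_left hz ha)
    have h6 := h4.trans (mul_le_mul (hWV _) h5 (norm_nonneg _) hδ)
    refine (add_le_add h3 h6).trans_eq ?_
    push_cast
    ring

lemma preactivation_zero (x : EuclideanSpace ℝ (Fin (p 0))) (l : ℕ)
    (hl : l < L + 1) : preactivation f 0 x l hl = 0 := by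
  cases l <;> simp [preactivation]

lemma continuous_preactivation (hf : Admissible a f) (x : EuclideanSpace ℝ (Fin (p 0))) (l : ℕ)
    (hl : l < L + 1) : Continuous fun W : Params L p => preactivation f W x l hl := by
  have key : ∀ {r c : ℕ} {A : Params L p → Matrix (Fin r) (Fin c) ℝ}
      {y : Params L p → EuclideanSpace ℝ (Fin c)}, Continuous A → Continuous y →
      Continuous fun W => Matrix.toEuclideanLin (A W) (y W) := by
    intro r c A y hA hy
    exact (PiLp.continuous_toLp 2 _).comp
      (hA.matrix_mulVec ((PiLp.continuous_ofLp 2 _).comp hy))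
  induction l with
  | zero => exact key (continuous_apply _) continuous_const
  | succ l ih =>
    refine key (continuous_apply _) (Continuous.comp ?_ (ih _))
    exact (LipschitzWith.of_dist_le' (K := a) fun z z' => by
      simpa [dist_eq_norm] using hf.lipschitz ⟨l, Nat.lt_of_succ_lt_succ hl⟩ z z').continuous

variable (hp : p (L + 1) = 1)

lemma network_zero (x : EuclideanSpace ℝ (Fin (p 0))) :
    network hp f 0 x = 0 := by
  simp [network, preactivation_zero]

lemma continuous_network (hf : Admissible a f) (x : EuclideanSpace ℝ (Fin (p 0))) :
    Continuous fun W : Params L p => network hp f W x :=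
  (continuous_apply _).comp ((PiLp.continuous_ofLp 2 _).comp (continuous_preactivation hf x L _))

lemma abs_network_sub_le (ha : 0 ≤ a) (hf : Admissible a f) {v w : ParamIndex L p → ℝ}
    (hv : ∑ q, |v q| ≤ 1) (hw : ∑ q, |w q| ≤ 1) (x : EuclideanSpace ℝ (Fin (p 0))) :
    |network hp f (toParams v) x - network hp f (toParams w) x| ≤
      a ^ L * ‖x‖ * ((L + 1) * Real.sqrt (∑ q, (v q - w q) ^ 2)) := by
  rw [← l1Penalty_toParams] at hv hw
  have h := norm_preactivation_sub_le ha hf (frobNorm_le_one hv) (frobNorm_le_one hw)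
    (frobNorm_toParams_sub_le v w) x L (Nat.lt_succ_self L)
  exact (PiLp.norm_apply_le (preactivation f (toParams v) x L (Nat.lt_succ_self L) -
    preactivation f (toParams w) x L (Nat.lt_succ_self L)) (Fin.cast hp.symm 0)).trans h

lemma sum_norm_sq_eq {n d : ℕ} (hn : 0 < n) (x : Fin n → EuclideanSpace ℝ (Fin d)) :
    ∑ i, ‖x i‖ ^ 2 = n * empNorm x ^ 2 := by
  have : (0 : ℝ) < n := by exact_mod_cast hn
  rw [empNorm, Real.sq_sqrt (div_nonneg (Finset.sum_nonneg fun i _ => sq_nonneg _) this.le)]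
  field_simp

/-! ### Uniform control of the noise over networks. -/

/-- With high probability, the noise is uniformly weakly correlated with the networks in the unit
ball of the `ℓ₁` penalty. -/
theorem exists_forall_abs_sum_network_mul_noise_le (ha : 0 ≤ a) (hf : Admissible a f) {n : ℕ}
    (hn : 0 < n) (x : Fin n → EuclideanSpace ℝ (Fin (p 0))) {S : Type*} [MeasurableSpace S]
    {μ : Measure S} [IsProbabilityMeasure μ] {K γ : ℝ} (hK : 0 < K) {u : Fin n → S → ℝ}
    (hu : SubGaussianNoise μ K γ u) :
    ∃ E : Set S, MeasurableSet E ∧ ENNReal.ofReal (1 - 1 / n) ≤ μ E ∧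
      ∀ ω ∈ E, ∀ W : Params L p, l1Penalty W ≤ 1 →
        |∑ i, network hp f W (x i) * u i ω| ≤
          Real.sqrt (2 * (K ^ 2 + 2 * γ ^ 2)) *
            (2 * (L + 1) * Real.sqrt n * (a ^ L * empNorm x)) *
            (76 * Real.sqrt (Real.log (2 * numParams L p)) * Real.sqrt (Real.log (2 * n))) := by
  have hs : 0 ≤ empNorm x := Real.sqrt_nonneg _
  -- Without entries the only parameter is zero; chaining needs a nonempty index set.
  rcases Nat.eq_zero_or_pos (numParams L p) with hP | hP
  · refine ⟨Set.univ, MeasurableSet.univ, ?_, fun ω _ W _ => ?_⟩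
    · rw [measure_univ]
      exact ENNReal.ofReal_le_one.2 (sub_le_self _ (by positivity))
    · have hem : IsEmpty (ParamIndex L p) :=
        Fintype.card_eq_zero_iff.1 ((card_paramIndex L p).trans hP)
      have hW : W = 0 := by
        funext l
        ext i j
        exact (hem.false ⟨l, i, j⟩).elim
      simp only [hW, network_zero hp, zero_mul, Finset.sum_const_zero, abs_zero]
      positivity
  rw [← card_paramIndex] at hP ⊢
  -- The process is read at `2v`, so that radius `1/2` in `v` covers the unit ball; this is the
  -- factor `2` in `ρ`.
  obtain ⟨E, hE, hμ, hb⟩ := exists_forall_abs_le_of_subGaussian_increments hP (μ := μ)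
    (fun v ω => ∑ i, network hp f (toParams ((2 : ℝ) • v)) (x i) * u i ω)
    (fun v => Finset.measurable_sum _ fun i _ => (hu.measurable i).const_mul _)
    (fun ω => continuous_finsetSum _ fun i _ => Continuous.mul_const
      ((continuous_network hp hf (x i)).comp (by
        refine continuous_pi fun l => continuous_matrix fun i j => ?_
        exact (continuous_apply (⟨l, i, j⟩ : ParamIndex L p)).const_smul (2 : ℝ))) _)
    (fun ω => by
      have h0 : toParams ((2 : ℝ) • (0 : ParamIndex L p → ℝ)) = 0 := by
        rw [smul_zero]; rfl
      simp only [h0, network_zero hp, zero_mul, Finset.sum_const_zero])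
    (ρ := Real.sqrt (2 * (K ^ 2 + 2 * γ ^ 2)) *
      (2 * (L + 1) * Real.sqrt n * (a ^ L * empNorm x))) (by positivity)
    (fun v w hv hw t ht => by
      have h2 : ∀ v : ParamIndex L p → ℝ, ∑ j, |v j| ≤ 1 / 2 → ∑ j, |((2 : ℝ) • v) j| ≤ 1 := by
        intro v hv
        simp only [Pi.smul_apply, smul_eq_mul, abs_mul, ← Finset.mul_sum]
        rw [abs_of_pos two_pos]
        linarith
      set d := Real.sqrt (∑ j, (v j - w j) ^ 2) with hd
      have hd2 : Real.sqrt (∑ j, (((2 : ℝ) • v) j - ((2 : ℝ) • w) j) ^ 2) = 2 * d := by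
        simp only [Pi.smul_apply, smul_eq_mul, ← mul_sub, mul_pow, ← Finset.mul_sum]
        rw [Real.sqrt_mul (by positivity), Real.sqrt_sq two_pos.le]
      have hinc : ∀ i, |network hp f (toParams ((2 : ℝ) • v)) (x i) -
          network hp f (toParams ((2 : ℝ) • w)) (x i)| ≤ 2 * (L + 1) * a ^ L * d * ‖x i‖ := by
        intro i
        refine (abs_network_sub_le hp ha hf (h2 v hv) (h2 w hw) (x i)).trans_eq ?_
        rw [hd2]; ring
      have h := hu.measure_lt_abs_sum_le hK
        (fun i => network hp f (toParams ((2 : ℝ) • v)) (x i) -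
          network hp f (toParams ((2 : ℝ) • w)) (x i))
        (D := 2 * (L + 1) * Real.sqrt n * (a ^ L * empNorm x) * d) (by positivity)
        (by
          calc _ ≤ ∑ i, (2 * (L + 1) * a ^ L * d * ‖x i‖) ^ 2 :=
                Finset.sum_le_sum fun i _ => by
                  rw [← sq_abs]; exact pow_le_pow_left₀ (abs_nonneg _) (hinc i) 2
            _ = (2 * (L + 1) * a ^ L * d) ^ 2 * (n * empNorm x ^ 2) := by
                simp only [mul_pow _ ‖x _‖]
                rw [← Finset.mul_sum, sum_norm_sq_eq hn]
            _ = (2 * (L + 1) * a ^ L * d) ^ 2 * (Real.sqrt n ^ 2 * empNorm x ^ 2) := by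
                rw [Real.sq_sqrt (Nat.cast_nonneg n)]
            _ ≤ _ := le_of_eq (by ring)) ht
      simp only [sub_mul, Finset.sum_sub_distrib] at h
      rwa [← mul_assoc] at h) hn
  refine ⟨E, hE, hμ, fun ω hω W hW => ?_⟩
  have h := hb ω hω ((1 / 2 : ℝ) • ofParams W) (by
    rw [← toParams_ofParams W, l1Penalty_toParams] at hW
    simp only [Pi.smul_apply, smul_eq_mul, abs_mul, ← Finset.mul_sum]
    rw [abs_of_pos (by norm_num)]
    linarith)
  simp only [smul_smul] at h
  norm_num at h
  simpa [toParams_ofParams] using h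

end Network

/-! ### The case `G = 0`: the kernel is the whole space and its complement is trivial. -/

lemma kernel_zero (r q : ℕ) : kernel (0 : Matrix (Fin r) (Fin q) ℝ) = ⊤ := by
  rw [kernel, map_zero, LinearMap.ker_zero]

lemma invNorm_zero (r q : ℕ) : invNorm (0 : Matrix (Fin r) (Fin q) ℝ) = 0 := by
  have h0 : ∀ y : (kernel (0 : Matrix (Fin r) (Fin q) ℝ))ᗮ,
      (y : EuclideanSpace ℝ (Fin q)) = 0 := by
    rintro ⟨y, hy⟩
    rwa [kernel_zero, Submodule.top_orthogonal_eq_bot, Submodule.mem_bot] at hy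
  have hset : {t | ∃ y : LinearMap.range (Matrix.toEuclideanLin (0 : Matrix (Fin r) (Fin q) ℝ)),
      vecL1 (y : EuclideanSpace ℝ (Fin r)) ≤ 1 ∧
        t = vecL1 ((inducedEquiv (0 : Matrix (Fin r) (Fin q) ℝ)).symm y :
          EuclideanSpace ℝ (Fin q))} = {0} := by
    ext t
    simp only [Set.mem_ofPred_eq, Set.mem_singleton_iff, h0]
    constructor
    · rintro ⟨_, _, rfl⟩
      simp [vecL1]
    · rintro rfl
      exact ⟨0, by simp [vecL1], by simp [vecL1]⟩
  rw [invNorm, hset, csSup_singleton]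

lemma maxInvNorm_zero (L : ℕ) (p m : ℕ → ℕ) : maxInvNorm (0 : RegMatrices L p m) = 0 := by
  have h : ∀ l, invNorm ((0 : RegMatrices L p m) l) = 0 := fun l => invNorm_zero _ _
  simp only [maxInvNorm, h]
  exact Finset.sup'_const _ _

lemma kernelProj_zero {r q c : ℕ} (W : Matrix (Fin q) (Fin c) ℝ) :
    kernelProj (0 : Matrix (Fin r) (Fin q) ℝ) W = W := by
  ext i j
  simp only [kernelProj, Matrix.of_apply]
  rw [Submodule.starProjection_eq_self_iff.2 (by rw [kernel_zero]; trivial)]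

lemma regularizer_zero {L : ℕ} {p m : ℕ → ℕ} (W : Params L p) :
    regularizer (0 : RegMatrices L p m) 1 W = l1Penalty W := by
  have h1 : ∀ l, matrixL1 ((0 : RegMatrices L p m) l * W l) = 0 := fun l => by
    simp [matrixL1]
  have h2 : ∀ l, kernelProj ((0 : RegMatrices L p m) l) (W l) = W l := fun l =>
    kernelProj_zero _
  simp only [regularizer, h1, h2, Finset.sum_const_zero, zero_add, one_mul, l1Penalty]

/-! ### The basic inequality for the estimator. -/

/-- The oracle inequality holds as soon as the tuning parameter dominates the noise. -/
lemma IsEstimator.predErrSq_le_oracleBound {n L : ℕ} {p : ℕ → ℕ} {hp : p (L + 1) = 1}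
    {f : Activations L p} {h : Params L p → ℝ} {x : Fin n → EuclideanSpace ℝ (Fin (p 0))}
    {g : EuclideanSpace ℝ (Fin (p 0)) → ℝ} {u : Fin n → ℝ} {lam κ : ℝ} {W : Params L p}
    (hne : (unitBall h).Nonempty)
    (hest : IsEstimator hp f h x (fun i => g (x i) + u i) lam κ W)
    (hnoise : ∀ V ∈ unitBall h, 2 / n * |∑ i, network hp f V (x i) * u i| ≤ lam) :
    predErrSq hp f x g κ W ≤ oracleBound hp f h x g lam := by
  obtain ⟨hκ, hW, hmin⟩ := hest
  obtain ⟨V₀, hV₀⟩ := hne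
  have : Nonempty {q : ℝ × Params L p // 0 ≤ q.1 ∧ q.2 ∈ unitBall h} := ⟨⟨(0, V₀), le_rfl, hV₀⟩⟩
  refine le_ciInf ?_
  rintro ⟨⟨κ', V⟩, hκ', hV⟩
  have hobj : ∀ (s : ℝ) (Z : Params L p), objective hp f x (fun i => g (x i) + u i) lam s Z =
      predErrSq hp f x g s Z - s * (2 / n * ∑ i, network hp f Z (x i) * u i) +
        1 / n * ∑ i, (2 * (g (x i) * u i) + u i ^ 2) + lam * s := by
    intro s Z
    have e : ∀ i, (g (x i) + u i - s * network hp f Z (x i)) ^ 2 =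
        (g (x i) - s * network hp f Z (x i)) ^ 2 - 2 * s * (network hp f Z (x i) * u i) +
          (2 * (g (x i) * u i) + u i ^ 2) := fun i => by ring
    simp only [objective, predErrSq, e, Finset.sum_add_distrib, Finset.sum_sub_distrib,
      ← Finset.mul_sum]
    ring
  have hcmp := hmin κ' V hκ' hV
  rw [hobj, hobj] at hcmp
  have hn2 : (0 : ℝ) ≤ 2 / n := by positivity
  have h1 : 2 / n * ∑ i, network hp f W (x i) * u i ≤ lam :=
    (mul_le_mul_of_nonneg_left (le_abs_self _) hn2).trans (hnoise W hW)
  have h2 : -lam ≤ 2 / n * ∑ i, network hp f V (x i) * u i := by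
    have := mul_le_mul_of_nonneg_left (neg_abs_le (∑ i, network hp f V (x i) * u i)) hn2
    have := hnoise V hV
    linarith
  have h3 := mul_le_mul_of_nonneg_left h1 hκ
  have h4 := mul_le_mul_of_nonneg_left h2 hκ'
  show _ ≤ predErrSq hp f x g κ' V + 2 * lam * κ'
  linarith

/-! ### The tuning parameter dominates the noise for large samples. -/

/-- The factor `(√2 / L) ^ (2 L - 1)` of the tuning parameter. -/
noncomputable def depthFactor (L : ℕ) : ℝ := (Real.sqrt 2 / L) ^ (2 * L - 1)

lemma depthFactor_pos {L : ℕ} (hL : 1 ≤ L) : 0 < depthFactor L := by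
  have : (0 : ℝ) < L := by exact_mod_cast hL
  exact pow_pos (by positivity) _

/-- The sample size from which on the tuning parameter dominates the noise. -/
noncomputable def sampleThreshold (L : ℕ) (s : ℝ) : ℕ :=
  ⌈Real.exp ((304 * Real.sqrt 2 * (L + 1) / (depthFactor L * s)) ^ 2)⌉₊

lemma sampleThreshold_antitoneOn (L : ℕ) : AntitoneOn (sampleThreshold L) (Set.Ioi 0) := by
  intro s hs t ht hst
  have hs' : 0 < s := hs
  have hd : 0 ≤ depthFactor L := pow_nonneg (by positivity) _
  rcases hd.eq_or_lt with h0 | h0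
  · simp [sampleThreshold, ← h0]
  · have ht' : 0 < t := ht
    unfold sampleThreshold
    gcongr

lemma sampleThreshold_pos (L : ℕ) (s : ℝ) : 0 < sampleThreshold L s :=
  Nat.ceil_pos.2 (Real.exp_pos _)

lemma le_mul_sqrt_log_of_sampleThreshold_le {L n : ℕ} (hL : 1 ≤ L) {s : ℝ} (hs : 0 < s)
    (hn : sampleThreshold L s ≤ n) :
    304 * Real.sqrt 2 * (L + 1) ≤ depthFactor L * s * Real.sqrt (Real.log (2 * n)) := by
  have hd := mul_pos (depthFactor_pos hL) hs
  have hn0 : (0 : ℝ) < n := by exact_mod_cast (sampleThreshold_pos L s).trans_le hn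
  have h1 : Real.exp ((304 * Real.sqrt 2 * (L + 1) / (depthFactor L * s)) ^ 2) ≤ 2 * n :=
    ((Nat.le_ceil _).trans (Nat.cast_le.2 hn)).trans (by linarith)
  have h2 := (Real.le_log_iff_exp_le (by positivity)).2 h1
  have h3 := Real.le_sqrt_of_sq_le h2
  rw [div_le_iff₀ hd] at h3
  linarith

/-- The noise level is at most the lower bound on the tuning parameter. -/
lemma noise_le_tuning {L n : ℕ} (hL : 1 ≤ L) {s c : ℝ} (hs : 0 ≤ s)
    (hn : sampleThreshold L s ≤ n) (P : ℕ) :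
    2 / n * (Real.sqrt (2 * c) * (2 * (L + 1) * Real.sqrt n * s) *
        (76 * Real.sqrt (Real.log (2 * P)) * Real.sqrt (Real.log (2 * n)))) ≤
      Real.sqrt c * s ^ 2 * (depthFactor L * Real.sqrt (Real.log (2 * P))) *
        (Real.log (2 * n) / Real.sqrt n) := by
  -- At `s = 0` both sides vanish, so the threshold, where division by zero gives `exp 0`, is not
  -- needed.
  rcases hs.eq_or_lt with rfl | hs0
  · simp
  have hn1 : 0 < n := (sampleThreshold_pos L s).trans_le hn
  have hn0 : (0 : ℝ) < n := by exact_mod_cast hn1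
  have hA := half_le_log_two_mul hn1
  have key := le_mul_sqrt_log_of_sampleThreshold_le hL hs0 hn
  set A := Real.log (2 * n)
  set R := Real.sqrt n with hR
  have hR0 : 0 < R := Real.sqrt_pos.2 hn0
  have hRn : (n : ℝ) = R * R := (Real.mul_self_sqrt hn0.le).symm
  have hAA : A = Real.sqrt A * Real.sqrt A := (Real.mul_self_sqrt (by linarith)).symm
  rw [Real.sqrt_mul two_pos.le]
  -- Here `304 = 2 * 2 * 76`; one factor `√A` and one factor `s` of the target are spent on the
  -- constants.
  calc _ = 304 * Real.sqrt 2 * (L + 1) *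
        (Real.sqrt c * s * Real.sqrt (Real.log (2 * P)) * Real.sqrt A / R) := by
        rw [hRn]; field_simp; ring
    _ ≤ depthFactor L * s * Real.sqrt A *
        (Real.sqrt c * s * Real.sqrt (Real.log (2 * P)) * Real.sqrt A / R) := by gcongr
    _ = Real.sqrt c * s ^ 2 * (depthFactor L * Real.sqrt (Real.log (2 * P))) *
        (Real.sqrt A * Real.sqrt A / R) := by ring
    _ = _ := by rw [← hAA]

end SparseNet

theorem mainTheorem4 :
    -- for `G = 0`: the constant `M_0` vanishes, the regularizer with `ν = 1` is the `ℓ₁` norm,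
    -- and the lower bound on the tuning parameter loses its factor `M_G + 1`
    (∀ (L : ℕ) (p m : ℕ → ℕ),
      SparseNet.maxInvNorm (0 : SparseNet.RegMatrices L p m) = 0 ∧
      (∀ W : SparseNet.Params L p,
        SparseNet.regularizer (0 : SparseNet.RegMatrices L p m) 1 W = SparseNet.l1Penalty W) ∧
      (∀ (C a s : ℝ) (P n : ℕ),
        SparseNet.tuningBound C (SparseNet.maxInvNorm (0 : SparseNet.RegMatrices L p m)) a L s P n
          = C * a ^ (2 * L) * s ^ 2
            * ((Real.sqrt 2 / L) ^ (2 * L - 1) * Real.sqrt (Real.log (2 * P)))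
            * (Real.log (2 * n) / Real.sqrt n))) ∧
    -- the oracle inequality: `C` depends only on `K` and `γ`, and the threshold `N` for the
    -- sample size depends only on `K`, `γ`, `L` and `a ^ L * ‖x‖_n`
    (∀ K γ : ℝ, 0 < K → 0 < γ →
      ∃ C : ℝ, 0 < C ∧ ∃ N : ℕ → ℝ → ℕ, (∀ L, AntitoneOn (N L) (Set.Ioi 0)) ∧
        ∀ (L : ℕ) (_ : 1 ≤ L) (p m : ℕ → ℕ) (hp : p (L + 1) = 1)
          (a : ℝ) (_ : 0 ≤ a) (f : SparseNet.Activations L p) (_ : SparseNet.Admissible a f)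
          (n : ℕ) (x : Fin n → EuclideanSpace ℝ (Fin (p 0)))
          (_ : N L (a ^ L * SparseNet.empNorm x) ≤ n)
          (g : EuclideanSpace ℝ (Fin (p 0)) → ℝ)
          (S : Type*) [MeasurableSpace S] (μ : Measure S) [IsProbabilityMeasure μ]
          (u : Fin n → S → ℝ) (_ : SparseNet.SubGaussianNoise μ K γ u)
          (lam : ℝ)
          (_ : C * a ^ (2 * L) * SparseNet.empNorm x ^ 2
            * ((Real.sqrt 2 / L) ^ (2 * L - 1)
              * Real.sqrt (Real.log (2 * SparseNet.numParams L p)))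
            * (Real.log (2 * n) / Real.sqrt n) ≤ lam),
          ∃ E : Set S, MeasurableSet E ∧ ENNReal.ofReal (1 - 1 / n) ≤ μ E ∧
            ∀ ω ∈ E, ∀ (κ : ℝ) (W : SparseNet.Params L p),
              SparseNet.IsEstimator hp f
                  (SparseNet.regularizer (0 : SparseNet.RegMatrices L p m) 1) x
                  (fun i => g (x i) + u i ω) lam κ W →
                SparseNet.predErrSq hp f x g κ W ≤
                  SparseNet.oracleBound hp f
                    (SparseNet.regularizer (0 : SparseNet.RegMatrices L p m) 1) x g lam) := by
  refine ⟨fun L p m => ⟨SparseNet.maxInvNorm_zero L p m, SparseNet.regularizer_zero,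
    fun C a s P n => by rw [SparseNet.tuningBound, SparseNet.maxInvNorm_zero, zero_add, mul_one]⟩,
    fun K γ hK hγ => ⟨Real.sqrt (K ^ 2 + 2 * γ ^ 2), by positivity, SparseNet.sampleThreshold,
      SparseNet.sampleThreshold_antitoneOn, ?_⟩⟩
  intro L hL p m hp a ha f hf n x hn g S _ μ _ u hu lam hlam
  have hs : 0 ≤ a ^ L * SparseNet.empNorm x := mul_nonneg (pow_nonneg ha L) (Real.sqrt_nonneg _)
  obtain ⟨E, hE, hμ, hb⟩ := SparseNet.exists_forall_abs_sum_network_mul_noise_le hp ha hf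
    ((SparseNet.sampleThreshold_pos _ _).trans_le hn) x hK hu
  refine ⟨E, hE, hμ, fun ω hω κ W hest => hest.predErrSq_le_oracleBound ⟨0, ?_⟩ fun V hV => ?_⟩
  · simp [SparseNet.unitBall, SparseNet.regularizer_zero, SparseNet.l1Penalty, SparseNet.matrixL1]
  · have hV' : SparseNet.l1Penalty V ≤ 1 := by
      rw [← SparseNet.regularizer_zero (m := m)]; exact hV
    refine (mul_le_mul_of_nonneg_left (hb ω hω V hV') (by positivity)).trans ?_
    refine (SparseNet.noise_le_tuning hL hs hn _).trans (le_trans (le_of_eq ?_) hlam)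
    rw [SparseNet.depthFactor]
    ring
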